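/- Let $\Phi=\{X_k\}$ be a Poisson point process on $\mathbb{R}^d$ with locally finite intensity measure $\Lambda$ (points may coincide if $\Lambda$ has atoms). Let $H:\mathbb{R}^d\to\mathbb{R}_+$ be an independent random field that is independent of $\Phi$, in the sense that the laws of $H(x)$ depend measurably on $x$ and that, given $\Phi$, the values $H(X_k)$ at the individual points of $\Phi$ are independent, the value at a point located at $x$ having the law of $H(x)$. Consider the Poisson shot noise $I=\sum_{X_k\in\Phi}H(X_k)\in[0,\infty]$. For $s\ge 0$ put $\mathcal{L}_H(s;x)=\mathbb{E}[e^{-sH(x)}]$. For a matrix $\mathbf{S}\in\mathbb{C}^{n\times n}$ and a random variable $Z$ with values in $[0,\infty]$, the matrix Laplace transform is $\boldsymbol{\mathcal{L}}_Z(\mathbf{S})=\mathbb{E}[\exp(-\mathbf{S}Z)]$ (entrywise expectation), where $\exp(-\mathbf{S}\cdot\infty)=\lim_{t\to\infty}\exp(-t\mathbf{S})$; write $\boldsymbol{\mathcal{L}}_H(\mathbf{S};x)=\boldsymbol{\mathcal{L}}_{H(x)}(\mathbf{S})$. Let $\mathbf{S}\in\mathbb{C}^{n\times n}$ be a matrix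 all of whose eigenvalues have strictly positive real part. (i) If $\int_{\mathbb{R}^d}(1-\mathcal{L}_H(s;x))\,\Lambda(dx)<\infty$ for all $s\ge 0$, then $I$ is finite almost surely, the matrix Laplace transforms $\boldsymbol{\mathcal{L}}_I(\mathbf{S})$ and $\boldsymbol{\mathcal{L}}_H(\mathbf{S};x)$ (for every $x$) exist, the matrix integral below converges absolutely entrywise, and $$\boldsymbol{\mathcal{L}}_I(\mathbf{S})=\exp\left(-\int_{\mathbb{R}^d}\bigl(\mathbf{I}-\boldsymbol{\mathcal{L}}_H(\mathbf{S};x)\bigr)\,\Lambda(dx)\right).$$ (ii) Otherwise, i.e. if this integral diverges for some $s\ge 0$, $I=\infty$ almost surely, $\boldsymbol{\mathcal{L}}_I(\mathbf{S})$ exists, and $\boldsymbol{\mathcal{L}}_I(\mathbf{S})=\mathbf{0}_{n\times n}$. -/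

import Mathlib

open MeasureTheory ProbabilityTheory
open scoped NNReal ENNReal

noncomputable section

/-- The counting measure `Φ(ω) = ∑_{k < N(ω)} δ_{X_k(ω)}` of a point process that is given by its
(finite or infinite) random number `N` of points and an enumeration `X_0, X_1, …` of them.
Points may coincide; the `X_k` with `k ≥ N` are not points of the process. -/
def pointMeasure {Ω E : Type*} [MeasurableSpace E]
    (N : Ω → ℕ∞) (X : ℕ → Ω → E) (ω : Ω) : Measure E :=
  Measure.sum fun k : ℕ => if (k : ℕ∞) < N ω then Measure.dirac (X k ω) else 0

/-- `Φ = ∑_{k < N} δ_{X_k}` is a Poisson point process with intensity measure `Λ`: the number of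
points in a bounded Borel set `B` is Poisson distributed with mean `Λ B`, and the numbers of points
in pairwise disjoint bounded Borel sets are independent. -/
structure IsPoissonPointProcess {Ω E : Type*} [MeasurableSpace Ω] [MeasurableSpace E]
    [Bornology E] (N : Ω → ℕ∞) (X : ℕ → Ω → E) (Λ : Measure E) (P : Measure Ω) : Prop where
  measurable_number : Measurable N
  measurable_point : ∀ k, Measurable (X k)
  hasLaw_count : ∀ B : Set E, MeasurableSet B → Bornology.IsBounded B →
    HasLaw (fun ω => pointMeasure N X ω B)
      ((poissonMeasure (Λ B).toNNReal).map (fun m : ℕ => (m : ℝ≥0∞))) P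
  indep_count : ∀ (m : ℕ) (B : Fin m → Set E), (∀ i, MeasurableSet (B i)) →
    (∀ i, Bornology.IsBounded (B i)) → Pairwise (Function.onFun Disjoint B) →
    iIndepFun (fun i ω => pointMeasure N X ω (B i)) P

/-- `Y_k`, `k < N`, are the values `H(X_k)` at the points of `Φ = ∑_{k < N} δ_{X_k}` of a
non-negative independent random field `H` that is independent of `Φ`: given `Φ`, the values at the
individual points are independent, and the value at a point located at `x` has the law of `H x`,
i.e. for measurable `A`, `B_k` and finite `s`,
`P(Φ ∈ A, k < N and Y_k ∈ B_k for all k ∈ s) = E[1{Φ ∈ A, k < N for all k ∈ s} ∏_{k ∈ s} p_k(X_k)]`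
with `p_k(x) = P(H x ∈ B_k)`.

This is the usual notion of an independently marked point process. An independent field over an
uncountable index set has no jointly measurable version, so that independence of the family
`(H x)_x`, and of this family from `Φ`, does not determine the joint law of the values at random
points; this law is what is specified here. The choice `Y k ω = H (X k ω) ω` is allowed; keeping
`Y` separate lets coincident points (at atoms of the intensity) carry independent values. -/
structure IsIndependentFieldAlong {Ω E : Type*} [MeasurableSpace Ω] [MeasurableSpace E]
    (N : Ω → ℕ∞) (X : ℕ → Ω → E) (H : E → Ω → ℝ≥0) (Y : ℕ → Ω → ℝ≥0) (P : Measure Ω) :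
    Prop where
  measurable_field : ∀ x, Measurable (H x)
  measurable_law : ∀ B : Set ℝ≥0, MeasurableSet B → Measurable fun x => P (H x ⁻¹' B)
  measurable_value : ∀ k, Measurable (Y k)
  condLaw : ∀ (s : Finset ℕ) (A : Set (ℕ∞ × (ℕ → E))) (B : ℕ → Set ℝ≥0),
    MeasurableSet A → (∀ k, MeasurableSet (B k)) →
    P {ω | (N ω, fun k => X k ω) ∈ A ∧ ∀ k ∈ s, (k : ℕ∞) < N ω ∧ Y k ω ∈ B k} =
      ∫⁻ ω in {ω | (N ω, fun k => X k ω) ∈ A ∧ ∀ k ∈ s, (k : ℕ∞) < N ω},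
        ∏ k ∈ s, P (H (X k ω) ⁻¹' B k) ∂P

/-- The shot noise `I = ∑_{k < N} Y_k ∈ [0, ∞]`, where `Y_k = H(X_k)`. -/
def shotNoise {Ω : Type*} (N : Ω → ℕ∞) (Y : ℕ → Ω → ℝ≥0) (ω : Ω) : ℝ≥0∞ :=
  ∑' k : ℕ, if (k : ℕ∞) < N ω then (Y k ω : ℝ≥0∞) else 0

/-- The scalar Laplace transform `E[exp(-s Z)]` of a non-negative random variable, `s ≥ 0`. -/
def laplaceTransform {Ω : Type*} [MeasurableSpace Ω] (P : Measure Ω) (Z : Ω → ℝ≥0) (s : ℝ≥0) : ℝ :=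
  ∫ ω, Real.exp (-((s : ℝ) * (Z ω : ℝ))) ∂P

/-- The matrix exponential `exp(-t S)` for `t ∈ [0, ∞]`; its value at `t = ∞` is the limit of
`exp(-t S)` as `t → ∞`, which exists if all eigenvalues of `S` have positive real part. -/
def expNegMul {n : ℕ} (S : Matrix (Fin n) (Fin n) ℂ) (t : ℝ≥0∞) : Matrix (Fin n) (Fin n) ℂ :=
  if t = ∞ then Filter.limUnder Filter.atTop (fun r : ℝ => NormedSpace.exp (-((r : ℂ) • S)))
  else NormedSpace.exp (-((t.toReal : ℂ) • S))

/-- The matrix Laplace transform of `Z` at `S` exists: all entries of `exp(-S Z)` are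
integrable. -/
def MatrixLaplaceExists {Ω : Type*} [MeasurableSpace Ω] {n : ℕ} (P : Measure Ω) (Z : Ω → ℝ≥0∞)
    (S : Matrix (Fin n) (Fin n) ℂ) : Prop :=
  ∀ i j, Integrable (fun ω => expNegMul S (Z ω) i j) P

/-- The matrix Laplace transform `E[exp(-S Z)]` (entrywise expectation) of a random variable `Z`
with values in `[0, ∞]`. -/
def matrixLaplace {Ω : Type*} [MeasurableSpace Ω] {n : ℕ} (P : Measure Ω) (Z : Ω → ℝ≥0∞)
    (S : Matrix (Fin n) (Fin n) ℂ) : Matrix (Fin n) (Fin n) ℂ :=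
  Matrix.of fun i j => ∫ ω, expNegMul S (Z ω) i j ∂P

/-- The matrix Laplace transform of the (finite) field value `H x`. -/
def fieldMatrixLaplace {Ω E : Type*} [MeasurableSpace Ω] {n : ℕ} (P : Measure Ω)
    (H : E → Ω → ℝ≥0) (S : Matrix (Fin n) (Fin n) ℂ) (x : E) : Matrix (Fin n) (Fin n) ℂ :=
  matrixLaplace P (fun ω => (H x ω : ℝ≥0∞)) S

end

/-! The matrices `exp(-tS)` all lie in the commutative algebra generated by `S`, so the argument
takes place in a commutative Banach algebra `A`, where a product over the points of `Φ` does not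
depend on their order. With `f t = exp(-ta)`, `a` representing `S`, the semigroup law turns `f` of a
finite sum of marks into a product over points.

For a bounded set `B`, the Laplace functional `E ∏ L(X_k) = exp(-∫_B (1 - L) dΛ)` holds in `A`: for
simple `L` it is a finite product of Poisson generating functions of independent counts, and bounded
`L` follow by dominated convergence (`IsPoissonPointProcess.integral_finprod`). Conditioning on the
finite set of indices of points in `B` replaces each mark by its mean given the location
(`IsIndependentFieldAlong.integral_finprod_value`).

The spectral condition makes `f` decay at infinity, so `f` extends continuously to `[0, ∞]` by `0`.
Along growing balls the expectations therefore always converge to that of the full shot noise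
(`tendsto_exp_neg_setIntegral_ball`). If `1 - E f(H x)` is integrable, the exponents converge too
and the formula follows; this integrability comes from the scalar hypothesis through `‖1 - f t‖ ≤ K
(1 - e^{-t})` (`exists_norm_one_sub_exp_le`). The scalar case `f t = e^{-st}` decides between `I <
∞` and `I = ∞`. -/

/-- The indices of the points of `∑_{k < N} δ_{X_k}` that lie in `B`. -/
def pointIndices {Ω E : Type*} (N : Ω → ℕ∞) (X : ℕ → Ω → E) (B : Set E) (ω : Ω) : Set ℕ :=
  {k | (k : ℕ∞) < N ω ∧ X k ω ∈ B}

/-! ### Counting the points in a set -/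

section Indices

variable {Ω E : Type*} {N : Ω → ℕ∞} {X : ℕ → Ω → E}

theorem pointMeasure_apply_eq_encard [MeasurableSpace E] {B : Set E} (hB : MeasurableSet B)
    (ω : Ω) : pointMeasure N X ω B = ((pointIndices N X B ω).encard : ℝ≥0∞) := by
  rw [pointMeasure, Measure.sum_apply _ hB, ← ENNReal.tsum_set_one,
    tsum_subtype (pointIndices N X B ω) fun _ => (1 : ℝ≥0∞)]
  refine tsum_congr fun k => ?_
  by_cases h : (k : ℕ∞) < N ω <;> by_cases h' : X k ω ∈ B <;>
    simp [pointIndices, h, h', hB, Set.indicator]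

theorem measurableSet_pointIndices_eq [MeasurableSpace Ω] [MeasurableSpace E] (hN : Measurable N)
    (hX : ∀ k, Measurable (X k)) {B : Set E} (hB : MeasurableSet B) (s : Set ℕ) :
    MeasurableSet {ω | pointIndices N X B ω = s} := by
  have h : {ω | pointIndices N X B ω = s} =
      ⋂ k : ℕ, {ω | ((k : ℕ∞) < N ω ∧ X k ω ∈ B) ↔ k ∈ s} := by
    ext ω
    simp [pointIndices, Set.ext_iff]
  rw [h]
  refine MeasurableSet.iInter fun k => ?_
  have h1 : MeasurableSet {ω | (k : ℕ∞) < N ω ∧ X k ω ∈ B} :=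
    (hN (Set.to_countable (Set.Ioi (k : ℕ∞))).measurableSet).inter (hX k hB)
  by_cases hk : k ∈ s
  · simpa [hk] using h1
  · simpa [hk, Set.compl_ofPred] using h1.compl

theorem ncard_pointIndices [MeasurableSpace E] {B : Set E} (hB : MeasurableSet B) (ω : Ω) :
    (pointIndices N X B ω).ncard = ⌊(pointMeasure N X ω B).toReal⌋₊ := by
  rw [pointMeasure_apply_eq_encard hB, Set.ncard]
  -- For an infinite index set both sides take the default value `0`.
  rcases eq_or_ne (pointIndices N X B ω).encard ⊤ with h | h
  · simp [h]
  · lift (pointIndices N X B ω).encard to ℕ using h with m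
    simp

end Indices

namespace IsPoissonPointProcess

variable {Ω E : Type*} [MeasurableSpace Ω] [MeasurableSpace E] [Bornology E]
  {N : Ω → ℕ∞} {X : ℕ → Ω → E} {Λ : Measure E} {P : Measure Ω}

theorem ae_finite_pointIndices (hΦ : IsPoissonPointProcess N X Λ P) {B : Set E}
    (hB : MeasurableSet B) (hb : Bornology.IsBounded B) :
    ∀ᵐ ω ∂P, (pointIndices N X B ω).Finite := by
  have hm : MeasurableSet {x : ℝ≥0∞ | x = ∞} := measurableSet_eq_fun measurable_id measurable_const
  have h := (hΦ.hasLaw_count B hB hb).measure_eq (p := fun x => x = ∞) hm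
  rw [Measure.map_apply (by fun_prop) hm] at h
  have h0 : P {ω | pointMeasure N X ω B = ∞} = 0 := by
    have he : (fun m : ℕ => (m : ℝ≥0∞)) ⁻¹' {x | x = ∞} = ∅ := by ext m; simp
    rw [h, he, measure_empty]
  filter_upwards [measure_eq_zero_iff_ae_notMem.1 h0] with ω hω
  by_contra hinf
  apply hω
  simp [pointMeasure_apply_eq_encard hB, Set.encard_eq_top_iff.2 hinf]

theorem hasLaw_ncard (hΦ : IsPoissonPointProcess N X Λ P) {B : Set E}
    (hB : MeasurableSet B) (hb : Bornology.IsBounded B) :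
    HasLaw (fun ω => (pointIndices N X B ω).ncard) (poissonMeasure (Λ B).toNNReal) P := by
  have hψ : Measurable fun x : ℝ≥0∞ => ⌊x.toReal⌋₊ := by fun_prop
  have h := hΦ.hasLaw_count B hB hb
  have he : (fun ω => (pointIndices N X B ω).ncard) =
      (fun x : ℝ≥0∞ => ⌊x.toReal⌋₊) ∘ fun ω => pointMeasure N X ω B :=
    funext fun ω => ncard_pointIndices hB ω
  rw [he]
  refine ⟨hψ.comp_aemeasurable h.aemeasurable, ?_⟩
  rw [← AEMeasurable.map_map_of_aemeasurable hψ.aemeasurable h.aemeasurable, h.map_eq,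
    Measure.map_map hψ (by fun_prop)]
  convert Measure.map_id
  ext m
  simp

theorem iIndepFun_ncard (hΦ : IsPoissonPointProcess N X Λ P) {ι : Type*} [Fintype ι]
    {B : ι → Set E} (hB : ∀ i, MeasurableSet (B i)) (hb : ∀ i, Bornology.IsBounded (B i))
    (hd : Pairwise (Function.onFun Disjoint B)) :
    iIndepFun (fun i ω => (pointIndices N X (B i) ω).ncard) P := by
  have hψ : Measurable fun x : ℝ≥0∞ => ⌊x.toReal⌋₊ := by fun_prop
  let e := Fintype.equivFin ι
  have h := hΦ.indep_count (Fintype.card ι) (fun i => B (e.symm i)) (fun i => hB _)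
    (fun i => hb _) (fun i j hij => hd (e.symm.injective.ne hij))
  have h' := (h.precomp (g := e) e.injective).comp (fun _ x => ⌊x.toReal⌋₊) fun _ => hψ
  convert h' using 2 with i
  ext ω
  simp [ncard_pointIndices (hB i)]

end IsPoissonPointProcess

/-! ### Poisson generating functions in a commutative Banach algebra -/

section Algebra

variable {A : Type*} [NormedCommRing A] [NormedAlgebra ℝ A] [CompleteSpace A]

omit [CompleteSpace A] in
theorem integrable_pow_poissonMeasure (r : ℝ≥0) (c : A) :
    Integrable (fun k : ℕ => c ^ k) (poissonMeasure r) := by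
  rw [integrable_poissonMeasure_iff]
  have h := (NormedSpace.norm_expSeries_summable' (𝕂 := ℝ) ((r : ℝ) • c)).mul_left (Real.exp (-r))
  refine h.congr fun k => ?_
  rw [smul_pow, smul_smul, norm_smul, Real.norm_of_nonneg (by positivity)]
  ring

theorem integral_pow_poissonMeasure (r : ℝ≥0) (c : A) :
    ∫ k : ℕ, c ^ k ∂(poissonMeasure r) = NormedSpace.exp ((r : ℝ) • (c - 1)) := by
  let _ : NormedAlgebra ℚ A := NormedAlgebra.restrictScalars ℚ ℝ A
  refine (hasSum_integral_poissonMeasure (integrable_pow_poissonMeasure r c)).unique ?_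
  have h := (NormedSpace.exp_series_hasSum_exp' (𝕂 := ℝ) ((r : ℝ) • c)).const_smul (Real.exp (-r))
  convert! h using 1
  · ext k
    rw [smul_pow, smul_smul, smul_smul]
    congr 1
    ring
  · rw [smul_sub, sub_eq_neg_add, NormedSpace.exp_add, Algebra.smul_def (Real.exp _),
      Real.exp_eq_exp_ℝ, NormedSpace.algebraMap_exp_comm, Algebra.algebraMap_eq_smul_one, neg_smul]

/-- Independence factors the expectation, one index at a time. Integrability is carried through the
same induction because the factorization is for a continuous bilinear map, here multiplication in
`A`. -/
theorem integral_prod_pow_of_iIndepFun_poisson {Ω : Type*} [MeasurableSpace Ω] {P : Measure Ω}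
    [IsProbabilityMeasure P] {ι : Type*} {K : ι → Ω → ℕ} {r : ι → ℝ≥0}
    (hK : ∀ i, HasLaw (K i) (poissonMeasure (r i)) P) (hi : iIndepFun K P) (c : ι → A)
    (s : Finset ι) :
    Integrable (fun ω => ∏ i ∈ s, c i ^ K i ω) P ∧
    ∫ ω, ∏ i ∈ s, c i ^ K i ω ∂P = ∏ i ∈ s, NormedSpace.exp ((r i : ℝ) • (c i - 1)) := by
  classical
  have hint : ∀ i, Integrable (fun k : ℕ => c i ^ k) (P.map (K i)) := fun i => by
    rw [(hK i).map_eq]; exact integrable_pow_poissonMeasure _ _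
  have hval : ∀ i, ∫ ω, c i ^ K i ω ∂P = NormedSpace.exp ((r i : ℝ) • (c i - 1)) := fun i => by
    rw [← integral_pow_poissonMeasure, ← (hK i).map_eq,
      integral_map (hK i).aemeasurable (hint i).1]
  induction s using Finset.induction_on with
  | empty => simp
  | insert a s ha ih =>
    have hind := hi.indepFun_finset₀ s {a} (by simpa using ha) fun i => (hK i).aemeasurable
    -- The partial product is a function of the vector of counts over `s`, which is independent of
    -- `K a`.
    let F : (s → ℕ) → A := fun v => ∏ i : s, c i ^ v i
    have hF : ∀ ω, ∏ i ∈ s, c i ^ K i ω = F fun i => K i ω := fun ω => by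
      simp only [F]
      rw [← Finset.prod_coe_sort]
    have hind2 : IndepFun (fun ω (i : s) => K i ω) (K a) P :=
      hind.comp (φ := id) (ψ := fun v : ({a} : Finset ι) → ℕ => v ⟨a, by simp⟩)
        measurable_id (by fun_prop)
    have hXm : AEMeasurable (fun ω (i : s) => K i ω) P :=
      aemeasurable_pi_lambda _ fun i => (hK i).aemeasurable
    have hFi : Integrable F (P.map fun ω (i : s) => K i ω) := by
      rw [integrable_map_measure .of_discrete hXm]
      exact ih.1.congr (.of_forall hF)
    have hB := hind2.integral_bilin_comp_comp hXm (hK a).aemeasurable hFi (hint a)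
      (ContinuousLinearMap.mul ℝ A)
    simp only [ContinuousLinearMap.mul_apply', ← hF] at hB
    simp only [Finset.prod_insert ha]
    constructor
    · borelize A
      have h2 : IndepFun (fun ω => F fun i : s => K i ω) (fun ω => c a ^ K a ω) P :=
        hind2.comp (φ := F) (ψ := fun k => c a ^ k) .of_discrete .of_discrete
      have h3 := h2.integrable_bilin ((integrable_map_measure .of_discrete hXm).1 hFi)
        ((integrable_map_measure .of_discrete (hK a).aemeasurable).1 (hint a))
        (ContinuousLinearMap.mul ℝ A)
      simp only [ContinuousLinearMap.mul_apply', ← hF] at h3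
      simpa only [mul_comm (c a ^ _)] using h3
    · simp_rw [mul_comm (c a ^ _)]
      rw [hB, ih.2, hval, mul_comm]

end Algebra

/-! ### Integration over a countable partition -/

section Partition

variable {Ω A ι : Type*} [MeasurableSpace Ω] [NormedAddCommGroup A] [Countable ι]
  {P : Measure Ω} {G : ι → Set Ω}

omit [Countable ι] in
theorem restrict_iUnion_eq_self (hc : ∀ᵐ ω ∂P, ∃ i, ω ∈ G i) : P.restrict (⋃ i, G i) = P := by
  rw [Measure.restrict_eq_self_of_ae_mem]
  filter_upwards [hc] with ω hω using Set.mem_iUnion.2 hω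

theorem aestronglyMeasurable_of_ae_cover (hc : ∀ᵐ ω ∂P, ∃ i, ω ∈ G i) {F : Ω → A}
    (hF : ∀ i, AEStronglyMeasurable F (P.restrict (G i))) : AEStronglyMeasurable F P := by
  rw [← restrict_iUnion_eq_self hc]
  exact aestronglyMeasurable_iUnion_iff.2 hF

theorem integral_eq_of_setIntegral_eq_on_cover [NormedSpace ℝ A]
    (hc : ∀ᵐ ω ∂P, ∃ i, ω ∈ G i) (hm : ∀ i, MeasurableSet (G i))
    (hd : Pairwise (Function.onFun Disjoint G)) {F F' : Ω → A} (hF : Integrable F P)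
    (hF' : Integrable F' P) (h : ∀ i, ∫ ω in G i, F ω ∂P = ∫ ω in G i, F' ω ∂P) :
    ∫ ω, F ω ∂P = ∫ ω, F' ω ∂P := by
  have h1 := hasSum_integral_iUnion hm hd hF.integrableOn
  have h2 := hasSum_integral_iUnion hm hd hF'.integrableOn
  rw [restrict_iUnion_eq_self hc] at h1 h2
  simp_rw [h] at h1
  exact h1.unique h2

end Partition

theorem pairwise_disjoint_pointIndices_eq {Ω E : Type*} {N : Ω → ℕ∞} {X : ℕ → Ω → E} {B : Set E} :
    Pairwise (Function.onFun Disjoint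
      fun s : Finset ℕ => {ω | pointIndices N X B ω = (s : Set ℕ)}) := by
  intro s t hst
  rw [Function.onFun, Set.disjoint_left]
  intro ω hs ht
  exact hst (Finset.coe_injective (hs.symm.trans ht))

/-! ### Laplace functional of the unmarked process on bounded sets -/

namespace IsPoissonPointProcess

variable {Ω E A : Type*} [MeasurableSpace Ω] [MeasurableSpace E] [Bornology E]
  {N : Ω → ℕ∞} {X : ℕ → Ω → E} {Λ : Measure E} {P : Measure Ω}
  [NormedCommRing A] [NormOneClass A]

theorem ae_exists_pointIndices_eq (hΦ : IsPoissonPointProcess N X Λ P) {B : Set E}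
    (hB : MeasurableSet B) (hb : Bornology.IsBounded B) :
    ∀ᵐ ω ∂P, ∃ s : Finset ℕ, ω ∈ {ω | pointIndices N X B ω = (s : Set ℕ)} := by
  filter_upwards [hΦ.ae_finite_pointIndices hB hb] with ω hω
  exact ⟨hω.toFinset, by simp⟩

theorem measurableSet_pointIndices_eq_coe (hΦ : IsPoissonPointProcess N X Λ P) {B : Set E}
    (hB : MeasurableSet B) (s : Finset ℕ) :
    MeasurableSet {ω | pointIndices N X B ω = (s : Set ℕ)} :=
  measurableSet_pointIndices_eq hΦ.measurable_number hΦ.measurable_point hB _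

/-- Poisson counts have all exponential moments; this supplies the dominating function for products
of factors bounded by `C`. -/
theorem integrable_pow_ncard (hΦ : IsPoissonPointProcess N X Λ P) {B : Set E}
    (hB : MeasurableSet B) (hb : Bornology.IsBounded B) (C : ℝ) :
    Integrable (fun ω => C ^ (pointIndices N X B ω).ncard) P := by
  have h := integrable_pow_poissonMeasure (Λ B).toNNReal C
  rw [← (hΦ.hasLaw_ncard hB hb).map_eq,
    integrable_map_measure .of_discrete (hΦ.hasLaw_ncard hB hb).aemeasurable] at h
  exact h

omit [MeasurableSpace Ω] [MeasurableSpace E] [Bornology E] in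
theorem norm_finprod_pointIndices_le {B : Set E} {ω : Ω} (hω : (pointIndices N X B ω).Finite)
    {g : ℕ → A} {C : ℝ} (hC : ∀ k ∈ pointIndices N X B ω, ‖g k‖ ≤ C) :
    ‖∏ᶠ k ∈ pointIndices N X B ω, g k‖ ≤ C ^ (pointIndices N X B ω).ncard := by
  lift pointIndices N X B ω to Finset ℕ using hω with s
  rw [finprod_mem_coe_finset, Set.ncard_coe_finset]
  refine (Finset.norm_prod_le _ _).trans ?_
  rw [← Finset.prod_const]
  exact Finset.prod_le_prod (fun _ _ => norm_nonneg _) fun k hk => hC k (by simpa using hk)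

omit [NormOneClass A] in
theorem aestronglyMeasurable_finprod (hΦ : IsPoissonPointProcess N X Λ P) {B : Set E}
    (hB : MeasurableSet B) (hb : Bornology.IsBounded B) {g : ℕ → Ω → A}
    (hg : ∀ k, AEStronglyMeasurable (g k) P) :
    AEStronglyMeasurable (fun ω => ∏ᶠ k ∈ pointIndices N X B ω, g k ω) P := by
  refine aestronglyMeasurable_of_ae_cover (hΦ.ae_exists_pointIndices_eq hB hb) fun s => ?_
  have h : AEStronglyMeasurable (fun ω => ∏ k ∈ s, g k ω) P :=
    Finset.aestronglyMeasurable_fun_prod s fun k _ => hg k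
  refine h.restrict.congr ?_
  filter_upwards [ae_restrict_mem (hΦ.measurableSet_pointIndices_eq_coe hB s)] with ω hω
  rw [show pointIndices N X B ω = s from hω, finprod_mem_coe_finset]

theorem integrable_finprod (hΦ : IsPoissonPointProcess N X Λ P) {B : Set E}
    (hB : MeasurableSet B) (hb : Bornology.IsBounded B) {g : ℕ → Ω → A}
    (hg : ∀ k, AEStronglyMeasurable (g k) P) {C : ℝ} (hC : ∀ k ω, ‖g k ω‖ ≤ C) :
    Integrable (fun ω => ∏ᶠ k ∈ pointIndices N X B ω, g k ω) P := by
  refine (hΦ.integrable_pow_ncard hB hb C).mono' (hΦ.aestronglyMeasurable_finprod hB hb hg) ?_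
  filter_upwards [hΦ.ae_finite_pointIndices hB hb] with ω hω
  exact norm_finprod_pointIndices_le hω fun k _ => hC k ω

omit [MeasurableSpace Ω] [Bornology E] [NormOneClass A] in
-- Grouping the points by the value of `L` leaves only the counts in the fibres.
theorem finprod_simpleFunc_eq {B : Set E} {ω : Ω} (hω : (pointIndices N X B ω).Finite)
    (L : SimpleFunc E A) : ∏ᶠ k ∈ pointIndices N X B ω, L (X k ω) =
      ∏ c ∈ L.range, c ^ (pointIndices N X (B ∩ L ⁻¹' {c}) ω).ncard := by
  classical
  obtain ⟨s, hs⟩ := hω.exists_finset_coe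
  rw [← hs, finprod_mem_coe_finset,
    ← Finset.prod_fiberwise_of_maps_to (g := fun k => L (X k ω)) (t := L.range) (by simp)]
  refine Finset.prod_congr rfl fun c _ => ?_
  have h : pointIndices N X (B ∩ L ⁻¹' {c}) ω = (s.filter fun k => L (X k ω) = c : Finset ℕ) := by
    rw [Finset.coe_filter]
    ext k
    have hk : k ∈ s ↔ (k : ℕ∞) < N ω ∧ X k ω ∈ B := by
      rw [← Finset.mem_coe, hs]; rfl
    simp [pointIndices, hk, and_assoc]
  rw [h, Set.ncard_coe_finset]
  exact Finset.prod_eq_pow_card fun k hk => (Finset.mem_filter.1 hk).2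

variable [NormedAlgebra ℝ A] [CompleteSpace A] [IsProbabilityMeasure P]

omit [NormOneClass A] in
-- The fibres of `L` cut `B` into disjoint pieces with independent Poisson counts. The product of
-- their generating functions is a single exponential, whose exponent sums to the integral of `L -
-- 1` over `B`.
theorem integral_finprod_simpleFunc (hΦ : IsPoissonPointProcess N X Λ P) {B : Set E}
    (hB : MeasurableSet B) (hb : Bornology.IsBounded B) (hΛ : Λ B ≠ ∞) (L : SimpleFunc E A) :
    ∫ ω, ∏ᶠ k ∈ pointIndices N X B ω, L (X k ω) ∂P =
      NormedSpace.exp (-∫ x in B, (1 - L x) ∂Λ) := by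
  let _ : NormedAlgebra ℚ A := NormedAlgebra.restrictScalars ℚ ℝ A
  have hfin : IsFiniteMeasure (Λ.restrict B) := ⟨by simpa using hΛ.lt_top⟩
  have hBc : ∀ c : L.range, MeasurableSet (B ∩ L ⁻¹' {(c : A)}) := fun c =>
    hB.inter (L.measurableSet_fiber _)
  have hbc : ∀ c : L.range, Bornology.IsBounded (B ∩ L ⁻¹' {(c : A)}) := fun c =>
    hb.subset Set.inter_subset_left
  have hd : Pairwise (Function.onFun Disjoint fun c : L.range => B ∩ L ⁻¹' {(c : A)}) := by
    intro c c' hcc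
    rw [Function.onFun, Set.disjoint_left]
    rintro x ⟨_, hx⟩ ⟨_, hx'⟩
    exact hcc (Subtype.ext (hx.symm.trans hx'))
  have hmain := (integral_prod_pow_of_iIndepFun_poisson
    (fun c => hΦ.hasLaw_ncard (hBc c) (hbc c)) (hΦ.iIndepFun_ncard hBc hbc hd)
    (fun c : L.range => (c : A)) Finset.univ).2
  have h1 : ∫ ω, ∏ᶠ k ∈ pointIndices N X B ω, L (X k ω) ∂P =
      ∫ ω, ∏ c : L.range, (c : A) ^ (pointIndices N X (B ∩ L ⁻¹' {(c : A)}) ω).ncard ∂P := by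
    refine integral_congr_ae ?_
    filter_upwards [hΦ.ae_finite_pointIndices hB hb] with ω hω
    rw [finprod_simpleFunc_eq hω, ← Finset.prod_coe_sort]
  have hr : ∀ c : L.range, (((Λ (B ∩ L ⁻¹' {(c : A)})).toNNReal : ℝ≥0) : ℝ) =
      (Λ.restrict B).real (L ⁻¹' {(c : A)}) := fun c => by
    rw [measureReal_restrict_apply (L.measurableSet_fiber _), Set.inter_comm]
    rfl
  rw [h1, hmain, ← NormedSpace.exp_sum]
  congr 1
  simp_rw [hr]
  rw [Finset.sum_coe_sort L.range fun c => (Λ.restrict B).real (L ⁻¹' {c}) • (c - 1)]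
  have hLi : Integrable L (Λ.restrict B) := L.integrable_of_isFiniteMeasure
  rw [integral_sub (integrable_const _) hLi, SimpleFunc.integral_eq_sum L hLi, neg_sub]
  simp_rw [smul_sub]
  rw [Finset.sum_sub_distrib, ← Finset.sum_smul, 
    sum_measureReal_preimage_singleton _ fun _ _ => L.measurableSet_fiber _, SimpleFunc.coe_range,
    Set.preimage_range]
  simp

theorem integral_finprod (hΦ : IsPoissonPointProcess N X Λ P) {B : Set E}
    (hB : MeasurableSet B) (hb : Bornology.IsBounded B) (hΛ : Λ B ≠ ∞) {L : E → A}
    (hL : StronglyMeasurable L) {C : ℝ} (hC : ∀ x, ‖L x‖ ≤ C) :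
    ∫ ω, ∏ᶠ k ∈ pointIndices N X B ω, L (X k ω) ∂P =
      NormedSpace.exp (-∫ x in B, (1 - L x) ∂Λ) := by
  let _ : NormedAlgebra ℚ A := NormedAlgebra.restrictScalars ℚ ℝ A
  have hfin : IsFiniteMeasure (Λ.restrict B) := ⟨by simpa using hΛ.lt_top⟩
  rcases isEmpty_or_nonempty E with hE | ⟨⟨x₀⟩⟩
  · have : ∀ ω, pointIndices N X B ω = ∅ := fun ω => (hE.false (X 0 ω)).elim
    simp [this, Measure.eq_zero_of_isEmpty]
  have hC0 : 0 ≤ C := (norm_nonneg _).trans (hC x₀)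
  have hlim : ∀ x, Filter.Tendsto (fun j => hL.approxBounded C j x) Filter.atTop (nhds (L x)) :=
    fun x => hL.tendsto_approxBounded_of_norm_le (hC x)
  have hle : ∀ j x, ‖hL.approxBounded C j x‖ ≤ C := hL.norm_approxBounded_le hC0
  have h1 : Filter.Tendsto
      (fun j => ∫ ω, ∏ᶠ k ∈ pointIndices N X B ω, hL.approxBounded C j (X k ω) ∂P) Filter.atTop
      (nhds (∫ ω, ∏ᶠ k ∈ pointIndices N X B ω, L (X k ω) ∂P)) := by
    refine tendsto_integral_of_dominated_convergence
      (fun ω => C ^ (pointIndices N X B ω).ncard) (fun j => ?_)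
      (hΦ.integrable_pow_ncard hB hb C) (fun j => ?_) ?_
    · exact hΦ.aestronglyMeasurable_finprod hB hb fun k =>
        ((SimpleFunc.stronglyMeasurable _).comp_measurable
          (hΦ.measurable_point k)).aestronglyMeasurable
    · filter_upwards [hΦ.ae_finite_pointIndices hB hb] with ω hω
      exact norm_finprod_pointIndices_le hω fun k _ => hle j _
    · filter_upwards [hΦ.ae_finite_pointIndices hB hb] with ω hω
      obtain ⟨s, hs⟩ := hω.exists_finset_coe
      simp_rw [← hs, finprod_mem_coe_finset]
      exact tendsto_finsetProd _ fun k _ => hlim _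
  have h2 : Filter.Tendsto (fun j => ∫ x in B, (1 - hL.approxBounded C j x) ∂Λ) Filter.atTop
      (nhds (∫ x in B, (1 - L x) ∂Λ)) := by
    refine tendsto_integral_of_dominated_convergence (fun _ => 1 + C)
      (fun j => (stronglyMeasurable_const.sub (SimpleFunc.stronglyMeasurable _)).aestronglyMeasurable)
      (integrable_const _) (fun j => .of_forall fun x => ?_)
      (.of_forall fun x => tendsto_const_nhds.sub (hlim x))
    exact (norm_sub_le _ _).trans (by rw [norm_one]; gcongr; exact hle j x)
  refine tendsto_nhds_unique h1 ?_
  simp_rw [hΦ.integral_finprod_simpleFunc hB hb hΛ]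
  exact (NormedSpace.exp_continuous.tendsto _).comp h2.neg

end IsPoissonPointProcess

/-! ### Independent marks: replacing values by conditional means -/

namespace IsIndependentFieldAlong

variable {Ω E A : Type*} [MeasurableSpace Ω] [MeasurableSpace E]
  {N : Ω → ℕ∞} {X : ℕ → Ω → E} {H : E → Ω → ℝ≥0} {Y : ℕ → Ω → ℝ≥0} {P : Measure Ω}

/-- The laws of the values `H x` of the field, as a kernel. -/
noncomputable def fieldKernel (hH : IsIndependentFieldAlong N X H Y P) : Kernel E ℝ≥0 where
  toFun x := P.map (H x)
  measurable' := Measure.measurable_of_measurable_coe _ fun B hB => by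
    simp_rw [Measure.map_apply (hH.measurable_field _) hB]
    exact hH.measurable_law B hB

theorem fieldKernel_apply (hH : IsIndependentFieldAlong N X H Y P) (x : E) :
    hH.fieldKernel x = P.map (H x) := rfl

theorem integral_fieldKernel [NormedAddCommGroup A] [NormedSpace ℝ A]
    (hH : IsIndependentFieldAlong N X H Y P) (x : E) {f : ℝ≥0 → A} (hf : StronglyMeasurable f) :
    ∫ y, f y ∂(hH.fieldKernel x) = ∫ ω, f (H x ω) ∂P := by
  rw [fieldKernel_apply, integral_map (hH.measurable_field x).aemeasurable
    hf.aestronglyMeasurable]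

variable [IsProbabilityMeasure P]

instance isMarkovKernel_fieldKernel (hH : IsIndependentFieldAlong N X H Y P) :
    IsMarkovKernel hH.fieldKernel :=
  ⟨fun x => Measure.isProbabilityMeasure_map (hH.measurable_field x).aemeasurable⟩

theorem setIntegral_prod_indicator (hH : IsIndependentFieldAlong N X H Y P)
    (hX : ∀ k, Measurable (X k)) (s : Finset ℕ) {G : Set (ℕ∞ × (ℕ → E))} (hG : MeasurableSet G)
    {B : ℕ → Set ℝ≥0} (hB : ∀ k, MeasurableSet (B k)) :
    ∫ ω in {ω | (N ω, fun k => X k ω) ∈ G ∧ ∀ k ∈ s, (k : ℕ∞) < N ω},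
        ∏ k ∈ s, (B k).indicator (fun _ => (1 : ℝ)) (Y k ω) ∂P =
      ∫ ω in {ω | (N ω, fun k => X k ω) ∈ G ∧ ∀ k ∈ s, (k : ℕ∞) < N ω},
        ∏ k ∈ s, (hH.fieldKernel (X k ω)).real (B k) ∂P := by
  have hmY : MeasurableSet {ω | ∀ k ∈ s, Y k ω ∈ B k} := by
    have : {ω | ∀ k ∈ s, Y k ω ∈ B k} = ⋂ k ∈ s, Y k ⁻¹' B k := by ext; simp
    rw [this]
    exact s.measurableSet_biInter fun k _ => hH.measurable_value k (hB k)
  have h1 : ∀ ω, ∏ k ∈ s, (B k).indicator (fun _ => (1 : ℝ)) (Y k ω) =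
      {ω | ∀ k ∈ s, Y k ω ∈ B k}.indicator (fun _ => (1 : ℝ)) ω := by
    intro ω
    by_cases h : ∀ k ∈ s, Y k ω ∈ B k
    · rw [Set.indicator_of_mem (show ω ∈ {ω | ∀ k ∈ s, Y k ω ∈ B k} from h)]
      exact Finset.prod_eq_one fun k hk => Set.indicator_of_mem (h k hk) _
    · rw [Set.indicator_of_notMem (show ω ∉ {ω | ∀ k ∈ s, Y k ω ∈ B k} from h)]
      push Not at h
      obtain ⟨k, hk, hkB⟩ := h
      exact Finset.prod_eq_zero hk (Set.indicator_of_notMem hkB _)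
  have h2 : ∀ ω, ∏ k ∈ s, (hH.fieldKernel (X k ω)).real (B k) =
      (∏ k ∈ s, P (H (X k ω) ⁻¹' B k)).toReal := by
    intro ω
    rw [ENNReal.toReal_prod]
    refine Finset.prod_congr rfl fun k _ => ?_
    rw [measureReal_def, fieldKernel_apply, Measure.map_apply (hH.measurable_field _) (hB k)]
  simp_rw [h1, h2]
  rw [integral_indicator_const _ hmY, smul_eq_mul, mul_one, measureReal_restrict_apply hmY,
    integral_toReal]
  · rw [← hH.condLaw s G B hG hB, measureReal_def]
    congr 2
    ext ω
    constructor
    · rintro ⟨h, h', h''⟩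
      exact ⟨h', fun k hk => ⟨h'' k hk, h k hk⟩⟩
    · rintro ⟨h, h'⟩
      exact ⟨fun k hk => (h' k hk).2, h, fun k hk => (h' k hk).1⟩
  · exact (s.measurable_fun_prod fun k _ => (hH.measurable_law _ (hB k)).comp (hX k)).aemeasurable
  · exact .of_forall fun ω => ENNReal.prod_lt_top fun k _ => measure_lt_top _ _

variable [NormedCommRing A] [NormedAlgebra ℝ A] [CompleteSpace A]

omit [CompleteSpace A] in
theorem prod_sum_smul_eq {s : Finset ℕ} (R : Finset A) (w : ℕ → A → ℝ) [DecidableEq A] :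
    ∏ k ∈ s, ∑ c ∈ R, w k c • c =
      ∑ p ∈ Fintype.piFinset fun _ : s => R, (∏ k : s, w k (p k)) • ∏ k : s, p k := by
  rw [← Finset.prod_coe_sort, Finset.prod_univ_sum]
  simp_rw [Finset.prod_smul]

/-- Both sides are multilinear in the values of `f`, so expanding the products reduces the claim to
indicators, where it is `condLaw`. -/
theorem setIntegral_prod_simpleFunc (hH : IsIndependentFieldAlong N X H Y P)
    (hX : ∀ k, Measurable (X k)) (s : Finset ℕ) {G : Set (ℕ∞ × (ℕ → E))} (hG : MeasurableSet G)
    (f : SimpleFunc ℝ≥0 A) :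
    ∫ ω in {ω | (N ω, fun k => X k ω) ∈ G ∧ ∀ k ∈ s, (k : ℕ∞) < N ω}, ∏ k ∈ s, f (Y k ω) ∂P =
      ∫ ω in {ω | (N ω, fun k => X k ω) ∈ G ∧ ∀ k ∈ s, (k : ℕ∞) < N ω},
        ∏ k ∈ s, ∫ y, f y ∂(hH.fieldKernel (X k ω)) ∂P := by
  classical
  have hf : ∀ y, f y = ∑ c ∈ f.range, (f ⁻¹' {c}).indicator (fun _ => (1 : ℝ)) y • c := by
    intro y
    rw [Finset.sum_eq_single (f y)]
    · simp
    · intro c _ hc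
      rw [Set.indicator_of_notMem (fun h => hc h.symm), zero_smul]
    · simp
  have hI : ∀ x, ∫ y, f y ∂(hH.fieldKernel x) =
      ∑ c ∈ f.range, (hH.fieldKernel x).real (f ⁻¹' {c}) • c := fun x =>
    SimpleFunc.integral_eq_sum f f.integrable_of_isFiniteMeasure
  have e1 : ∀ ω, ∏ k ∈ s, f (Y k ω) = ∑ p ∈ Fintype.piFinset fun _ : s => f.range,
      (∏ k : s, (f ⁻¹' {p k}).indicator (fun _ => (1 : ℝ)) (Y k ω)) • ∏ k : s, p k := fun ω => by
    rw [Finset.prod_congr rfl fun k _ => hf (Y k ω)]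
    exact prod_sum_smul_eq f.range fun k c => (f ⁻¹' {c}).indicator (fun _ => (1 : ℝ)) (Y k ω)
  have e2 : ∀ ω, ∏ k ∈ s, ∫ y, f y ∂(hH.fieldKernel (X k ω)) =
      ∑ p ∈ Fintype.piFinset fun _ : s => f.range,
        (∏ k : s, (hH.fieldKernel (X k ω)).real (f ⁻¹' {p k})) • ∏ k : s, p k := fun ω => by
    rw [Finset.prod_congr rfl fun k _ => hI (X k ω)]
    exact prod_sum_smul_eq f.range fun k c => (hH.fieldKernel (X k ω)).real (f ⁻¹' {c})
  simp_rw [e1, e2]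
  rw [integral_finsetSum, integral_finsetSum]
  · refine Finset.sum_congr rfl fun p _ => ?_
    rw [integral_smul_const, integral_smul_const]
    congr 1
    -- `condLaw` wants a set for every index; outside `s` any measurable set will do.
    let B : ℕ → Set ℝ≥0 := fun k => if h : k ∈ s then f ⁻¹' {p ⟨k, h⟩} else Set.univ
    have hBk : ∀ k : s, B k = f ⁻¹' {p k} := fun k => by simp [B]
    have hB : ∀ k, MeasurableSet (B k) := by
      intro k
      by_cases h : k ∈ s
      · simpa only [B, h, dif_pos] using f.measurableSet_fiber _
      · simp [B, h]
    have := hH.setIntegral_prod_indicator hX s hG hB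
    simp_rw [← Finset.prod_coe_sort s, hBk] at this
    exact this
  · intro p _
    refine Integrable.smul_const ?_ _
    refine Integrable.of_bound (C := 1) (Measurable.aestronglyMeasurable ?_) (.of_forall fun ω => ?_)
    · exact Finset.univ.measurable_fun_prod fun k _ =>
        (hH.fieldKernel.measurable_coe (f.measurableSet_fiber _)).ennreal_toReal.comp (hX k)
    · rw [Real.norm_of_nonneg (Finset.prod_nonneg fun _ _ => measureReal_nonneg)]
      exact Finset.prod_le_one (fun _ _ => measureReal_nonneg) fun _ _ => measureReal_le_one
  · intro p _
    refine Integrable.smul_const ?_ _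
    refine Integrable.of_bound (C := 1) (Measurable.aestronglyMeasurable ?_) (.of_forall fun ω => ?_)
    · exact Finset.univ.measurable_fun_prod fun k _ =>
        (measurable_const.indicator (f.measurableSet_fiber _)).comp (hH.measurable_value k)
    · have h0 : ∀ k : s, 0 ≤ (f ⁻¹' {p k}).indicator (fun _ => (1 : ℝ)) (Y k ω) := fun k =>
        Set.indicator_nonneg (fun _ _ => zero_le_one) _
      rw [Real.norm_of_nonneg (Finset.prod_nonneg fun k _ => h0 k)]
      exact Finset.prod_le_one (fun k _ => h0 k) fun k _ =>
        Set.indicator_le_self' (fun _ _ => zero_le_one) _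

variable [NormOneClass A]

theorem setIntegral_prod (hH : IsIndependentFieldAlong N X H Y P)
    (hX : ∀ k, Measurable (X k)) (s : Finset ℕ) {G : Set (ℕ∞ × (ℕ → E))} (hG : MeasurableSet G)
    {f : ℝ≥0 → A} (hf : StronglyMeasurable f) {C : ℝ} (hC : ∀ y, ‖f y‖ ≤ C) :
    ∫ ω in {ω | (N ω, fun k => X k ω) ∈ G ∧ ∀ k ∈ s, (k : ℕ∞) < N ω}, ∏ k ∈ s, f (Y k ω) ∂P =
      ∫ ω in {ω | (N ω, fun k => X k ω) ∈ G ∧ ∀ k ∈ s, (k : ℕ∞) < N ω},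
        ∏ k ∈ s, ∫ y, f y ∂(hH.fieldKernel (X k ω)) ∂P := by
  have hC0 : 0 ≤ C := (norm_nonneg _).trans (hC 0)
  have hlim : ∀ y, Filter.Tendsto (fun j => hf.approxBounded C j y) Filter.atTop (nhds (f y)) :=
    fun y => hf.tendsto_approxBounded_of_norm_le (hC y)
  have hle : ∀ j y, ‖hf.approxBounded C j y‖ ≤ C := hf.norm_approxBounded_le hC0
  have hbound : ∀ g : ℕ → A, (∀ k, ‖g k‖ ≤ C) → ‖∏ k ∈ s, g k‖ ≤ C ^ s.card := fun g hg => by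
    refine (Finset.norm_prod_le _ _).trans ?_
    rw [← Finset.prod_const]
    exact Finset.prod_le_prod (fun _ _ => norm_nonneg _) fun k _ => hg k
  refine tendsto_nhds_unique (f := fun j =>
    ∫ ω in {ω | (N ω, fun k => X k ω) ∈ G ∧ ∀ k ∈ s, (k : ℕ∞) < N ω},
      ∏ k ∈ s, hf.approxBounded C j (Y k ω) ∂P) (l := Filter.atTop) ?_ ?_
  · refine tendsto_integral_of_dominated_convergence (fun _ => C ^ s.card) (fun j => ?_)
      (integrable_const _) (fun j => .of_forall fun ω => hbound _ fun k => hle _ _)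
      (.of_forall fun ω => tendsto_finsetProd _ fun k _ => hlim _)
    exact Finset.aestronglyMeasurable_fun_prod s fun k _ =>
      ((SimpleFunc.stronglyMeasurable _).comp_measurable
        (hH.measurable_value k)).aestronglyMeasurable
  · simp_rw [hH.setIntegral_prod_simpleFunc hX s hG]
    refine tendsto_integral_of_dominated_convergence (fun _ => C ^ s.card) (fun j => ?_)
      (integrable_const _) (fun j => .of_forall fun ω => hbound _ fun k => ?_)
      (.of_forall fun ω => tendsto_finsetProd _ fun k _ => ?_)
    · exact Finset.aestronglyMeasurable_fun_prod s fun k _ =>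
        ((SimpleFunc.stronglyMeasurable _).integral_kernel.comp_measurable
          (hX k)).aestronglyMeasurable
    · simpa using norm_integral_le_of_norm_le_const (μ := hH.fieldKernel (X k ω))
        (.of_forall fun y => hle j y)
    · exact tendsto_integral_of_dominated_convergence (fun _ => C)
        (fun j => (SimpleFunc.stronglyMeasurable _).aestronglyMeasurable) (integrable_const _)
        (fun j => .of_forall fun y => hle j y) (.of_forall hlim)

/-- The Laplace functional of the points in a bounded set, marked by the values of the field. -/
theorem integral_finprod_value [Bornology E] {Λ : Measure E}
    (hH : IsIndependentFieldAlong N X H Y P)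
    (hΦ : IsPoissonPointProcess N X Λ P) {B : Set E} (hB : MeasurableSet B)
    (hb : Bornology.IsBounded B) (hΛ : Λ B ≠ ∞) {f : ℝ≥0 → A} (hf : StronglyMeasurable f) {C : ℝ}
    (hC : ∀ y, ‖f y‖ ≤ C) :
    ∫ ω, ∏ᶠ k ∈ pointIndices N X B ω, f (Y k ω) ∂P =
      NormedSpace.exp (-∫ x in B, (1 - ∫ ω, f (H x ω) ∂P) ∂Λ) := by
  have hL : StronglyMeasurable fun x => ∫ y, f y ∂(hH.fieldKernel x) := hf.integral_kernel
  have hLC : ∀ x, ‖∫ y, f y ∂(hH.fieldKernel x)‖ ≤ C := fun x => by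
    simpa using norm_integral_le_of_norm_le_const (μ := hH.fieldKernel x) (.of_forall hC)
  have h := hΦ.integral_finprod hB hb hΛ hL hLC
  simp_rw [hH.integral_fieldKernel _ hf] at h
  rw [← h]
  simp_rw [← hH.integral_fieldKernel _ hf]
  -- Almost surely the index set is one of countably many finite sets `s`; on each such cell the
  -- products run over a fixed `s`.
  refine integral_eq_of_setIntegral_eq_on_cover (hΦ.ae_exists_pointIndices_eq hB hb)
    (hΦ.measurableSet_pointIndices_eq_coe hB) pairwise_disjoint_pointIndices_eq
    (hΦ.integrable_finprod hB hb
      (fun k => (hf.comp_measurable (hH.measurable_value k)).aestronglyMeasurable)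
      fun k ω => hC _)
    (hΦ.integrable_finprod hB hb
      (fun k => (hL.comp_measurable (hΦ.measurable_point k)).aestronglyMeasurable)
      fun k ω => hLC _) fun s => ?_
  -- The cell must be an event of `(N, X)`, so it is written on the path space with the coordinate
  -- projections in place of `N` and `X`.
  have hG : MeasurableSet {q : ℕ∞ × (ℕ → E) |
      pointIndices Prod.fst (fun k (q : ℕ∞ × (ℕ → E)) => q.2 k) B q = (s : Set ℕ)} :=
    measurableSet_pointIndices_eq measurable_fst
      (fun k => (measurable_pi_apply k).comp measurable_snd) hB _
  have hs := hH.setIntegral_prod hΦ.measurable_point s hG hf hC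
  have he : {ω | (N ω, fun k => X k ω) ∈ {q : ℕ∞ × (ℕ → E) |
      pointIndices Prod.fst (fun k (q : ℕ∞ × (ℕ → E)) => q.2 k) B q = (s : Set ℕ)} ∧ ∀ k ∈ s, (k : ℕ∞) < N ω} =
      {ω | pointIndices N X B ω = (s : Set ℕ)} := by
    ext ω
    constructor
    · exact fun h => h.1
    · intro h
      refine ⟨h, fun k hk => ?_⟩
      have : k ∈ pointIndices N X B ω := by
        rw [show pointIndices N X B ω = s from h]; exact hk
      exact this.1
  rw [he] at hs
  have hm := hΦ.measurableSet_pointIndices_eq_coe hB s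
  convert hs using 1 <;>
  · refine setIntegral_congr_fun hm fun ω hω => ?_
    simp only [show pointIndices N X B ω = s from hω, finprod_mem_coe_finset]

end IsIndependentFieldAlong

/-! ### Vanishing semigroups and their extension to `[0, ∞]` -/

/-- A continuous semigroup `(f t)_{t ≥ 0}` in a normed ring with `f t → 0` as `t → ∞`. -/
structure IsVanishingSemigroup {A : Type*} [NormedRing A] (f : ℝ≥0 → A) : Prop where
  map_zero : f 0 = 1
  map_add : ∀ s t, f (s + t) = f s * f t
  continuous : Continuous f
  tendsto : Filter.Tendsto f Filter.atTop (nhds 0)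

/-- The extension of `f` to `[0, ∞]` by `0` at `∞`. -/
noncomputable def extendZero {A : Type*} [Zero A] (f : ℝ≥0 → A) (t : ℝ≥0∞) : A :=
  if t = ∞ then 0 else f t.toNNReal

theorem extendZero_top {A : Type*} [Zero A] (f : ℝ≥0 → A) : extendZero f ∞ = 0 := if_pos rfl

theorem extendZero_coe {A : Type*} [Zero A] (f : ℝ≥0 → A) (t : ℝ≥0) : extendZero f t = f t := by
  simp [extendZero]

namespace IsVanishingSemigroup

theorem exists_norm_le {A : Type*} [NormedRing A] {f : ℝ≥0 → A} (hf : IsVanishingSemigroup f) :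
    ∃ C, ∀ t, ‖f t‖ ≤ C := by
  obtain ⟨R, hR⟩ := Filter.eventually_atTop.1 (hf.tendsto.norm.eventually_le_const
    (show ‖(0 : A)‖ < 1 by simp))
  obtain ⟨C, hC⟩ := (isCompact_Icc (a := (0 : ℝ≥0)) (b := R)).exists_bound_of_continuousOn
    hf.continuous.continuousOn
  refine ⟨max C 1, fun t => ?_⟩
  rcases le_total t R with h | h
  · exact (hC t ⟨zero_le, h⟩).trans (le_max_left _ _)
  · exact (hR t h).trans (le_max_right _ _)

theorem map_sum {A ι : Type*} [NormedCommRing A] {f : ℝ≥0 → A} (hf : IsVanishingSemigroup f)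
    (s : Finset ι) (y : ι → ℝ≥0) : f (∑ k ∈ s, y k) = ∏ k ∈ s, f (y k) := by
  classical
  induction s using Finset.induction_on with
  | empty => simp [hf.map_zero]
  | insert a s ha ih => rw [Finset.sum_insert ha, Finset.prod_insert ha, hf.map_add, ih]

theorem continuous_extendZero {A : Type*} [NormedRing A] {f : ℝ≥0 → A}
    (hf : IsVanishingSemigroup f) : Continuous (extendZero f) := by
  rw [continuous_iff_continuousAt]
  intro t
  induction t with
  | top =>
    rw [ContinuousAt, extendZero_top, Metric.tendsto_nhds]
    intro ε hε
    obtain ⟨M, hM⟩ := Filter.eventually_atTop.1 ((Metric.tendsto_nhds.1 hf.tendsto) ε hε)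
    filter_upwards [lt_mem_nhds (ENNReal.coe_lt_top (r := M))] with t ht
    induction t with
    | top => simpa [extendZero_top] using hε
    | coe t => rw [extendZero_coe]; exact hM t (by exact_mod_cast ht.le)
  | coe t =>
    rw [ContinuousAt, extendZero_coe, ENNReal.nhds_coe, Filter.tendsto_map'_iff]
    refine Filter.Tendsto.congr (fun x => (extendZero_coe f x).symm) (hf.continuous.tendsto t)

theorem norm_extendZero_le {A : Type*} [NormedRing A] {f : ℝ≥0 → A} {C : ℝ} (hC : ∀ t, ‖f t‖ ≤ C)
    (t : ℝ≥0∞) : ‖extendZero f t‖ ≤ C := by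
  induction t with
  | top => simpa [extendZero_top] using (norm_nonneg _).trans (hC 0)
  | coe t => rw [extendZero_coe]; exact hC t

theorem real_exp {s : ℝ} (hs : 0 < s) :
    IsVanishingSemigroup fun t : ℝ≥0 => Real.exp (-(s * t)) where
  map_zero := by simp
  map_add a b := by rw [← Real.exp_add]; congr 1; push_cast; ring
  continuous := by fun_prop
  tendsto := Real.tendsto_exp_neg_atTop_nhds_zero.comp
    ((NNReal.tendsto_coe_atTop.2 Filter.tendsto_id).const_mul_atTop hs)

end IsVanishingSemigroup

/-! ### Decay of `exp(-ta)` from the spectrum of `a` -/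

section Exponential

variable {A : Type*} [NormedCommRing A] [NormOneClass A] [NormedAlgebra ℂ A] [CompleteSpace A]

omit [NormOneClass A] in
-- By Gelfand's formula the powers are eventually dominated by a geometric sequence.
theorem tendsto_pow_nhds_zero_of_spectralRadius_lt_one {b : A} (hb : spectralRadius ℂ b < 1) :
    Filter.Tendsto (fun n : ℕ => b ^ n) Filter.atTop (nhds 0) := by
  obtain ⟨r, hr, hr1⟩ := ENNReal.lt_iff_exists_nnreal_btwn.1 hb
  have h := spectrum.pow_nnnorm_pow_one_div_tendsto_nhds_spectralRadius b
  refine squeeze_zero_norm' (a := fun n : ℕ => (r : ℝ) ^ n) ?_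
    (tendsto_pow_atTop_nhds_zero_of_lt_one r.2 (by exact_mod_cast hr1))
  filter_upwards [h.eventually_le_const hr, Filter.eventually_gt_atTop 0] with n hn hn0
  have h2 := (ENNReal.rpow_le_rpow hn (Nat.cast_nonneg n : (0 : ℝ) ≤ n))
  rw [← ENNReal.rpow_mul, one_div_mul_cancel (by positivity), ENNReal.rpow_one,
    ENNReal.rpow_natCast] at h2
  have h3 : ‖b ^ n‖₊ ≤ r ^ n := by exact_mod_cast h2
  exact_mod_cast h3

/-- In a commutative Banach algebra the spectrum consists of the values of characters, and a
character `φ` sends `exp(-a)` to `exp(-φ a)`, of modulus `e^{-Re φ a} < 1`. -/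
theorem spectralRadius_exp_neg_lt_one {a : A} (ha : ∀ z ∈ spectrum ℂ a, 0 < z.re) :
    spectralRadius ℂ (NormedSpace.exp (-a)) < 1 := by
  have : Nontrivial A := NormOneClass.nontrivial
  let _ : NormedAlgebra ℚ A := NormedAlgebra.restrictScalars ℚ ℂ A
  refine spectrum.spectralRadius_lt_of_forall_lt _ (r := 1) fun z hz => ?_
  obtain ⟨φ, hφ⟩ := WeakDual.CharacterSpace.mem_spectrum_iff_exists.1 hz
  have h1 : φ (NormedSpace.exp (-a)) = NormedSpace.exp (φ (-a)) :=
    NormedSpace.map_exp φ (map_continuous φ) _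
  have h2 := ha _ (AlgHom.apply_mem_spectrum φ a)
  rw [← hφ, h1, ← Complex.exp_eq_exp_ℂ, map_neg, ← NNReal.coe_lt_coe, coe_nnnorm,
    Complex.norm_exp]
  simpa using h2

theorem isVanishingSemigroup_exp {a : A} (ha : ∀ z ∈ spectrum ℂ a, 0 < z.re) :
    IsVanishingSemigroup fun t : ℝ≥0 => NormedSpace.exp (-(((t : ℝ) : ℂ) • a)) := by
  let _ : NormedAlgebra ℚ A := NormedAlgebra.restrictScalars ℚ ℂ A
  have hadd : ∀ s t : ℝ≥0, NormedSpace.exp (-((((s + t : ℝ≥0) : ℝ) : ℂ) • a)) =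
      NormedSpace.exp (-(((s : ℝ) : ℂ) • a)) * NormedSpace.exp (-(((t : ℝ) : ℂ) • a)) := by
    intro s t
    rw [← NormedSpace.exp_add]
    congr 1
    push_cast
    rw [add_smul, neg_add]
  have hcont : Continuous fun t : ℝ≥0 => NormedSpace.exp (-(((t : ℝ) : ℂ) • a)) :=
    NormedSpace.exp_continuous.comp (by fun_prop)
  refine ⟨by simp, hadd, hcont, ?_⟩
  obtain ⟨C, hC⟩ := (isCompact_Icc (a := (0 : ℝ≥0)) (b := 1)).exists_bound_of_continuousOn
    hcont.continuousOn
  have hpow := ((tendsto_pow_nhds_zero_of_spectralRadius_lt_one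
    (spectralRadius_exp_neg_lt_one ha)).comp
      (tendsto_nat_floor_atTop (α := ℝ≥0))).norm.mul_const C
  rw [norm_zero, zero_mul] at hpow
  refine squeeze_zero_norm (fun t => ?_) hpow
  -- The integer part gives a power of `exp(-a)`; the fractional part stays in `[0, 1]`, where the
  -- norm is at most `C`.
  have ht : t = (⌊t⌋₊ : ℝ≥0) + (t - ⌊t⌋₊) := (add_tsub_cancel_of_le (Nat.floor_le zero_le)).symm
  conv_lhs => rw [ht]
  rw [hadd]
  refine (norm_mul_le _ _).trans ?_
  have h1 : NormedSpace.exp (-((((⌊t⌋₊ : ℝ≥0) : ℝ) : ℂ) • a)) =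
      NormedSpace.exp (-a) ^ ⌊t⌋₊ := by
    rw [← NormedSpace.exp_nsmul]
    congr 1
    simp [Nat.cast_smul_eq_nsmul]
  rw [h1]
  refine mul_le_mul_of_nonneg_left (hC _ ⟨zero_le, ?_⟩) (norm_nonneg _)
  rw [tsub_le_iff_left]
  exact (Nat.lt_floor_add_one t).le

/-- The left side is Lipschitz near `0` and bounded at infinity, just like `1 - e^{-t}`. This lets
the scalar Laplace transform at `s = 1` control the algebra-valued integrand. -/
theorem exists_norm_one_sub_exp_le {a : A} (ha : ∀ z ∈ spectrum ℂ a, 0 < z.re) :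
    ∃ K, ∀ t : ℝ≥0, ‖1 - NormedSpace.exp (-(((t : ℝ) : ℂ) • a))‖ ≤ K * (1 - Real.exp (-t)) := by
  let _ : NormedAlgebra ℚ A := NormedAlgebra.restrictScalars ℚ ℂ A
  obtain ⟨C, hC⟩ := (isVanishingSemigroup_exp ha).exists_norm_le
  have hC0 : 0 ≤ C := (norm_nonneg _).trans (hC 0)
  have hsm : ∀ t : ℝ, -((t : ℂ) • a) = t • (-a) := fun t => by
    rw [smul_neg]; rfl
  have hlip : ∀ t : ℝ≥0, ‖1 - NormedSpace.exp (-(((t : ℝ) : ℂ) • a))‖ ≤ C * ‖a‖ * t := by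
    intro t
    have h := (convex_Ici (0 : ℝ)).norm_image_sub_le_of_norm_hasDerivWithin_le
      (f := fun u : ℝ => NormedSpace.exp (u • (-a)))
      (f' := fun u : ℝ => NormedSpace.exp (u • (-a)) * (-a)) (C := C * ‖a‖) (x := 0) (y := t)
      (fun u _ => (hasDerivAt_exp_smul_const (𝕂 := ℝ) (-a) u).hasDerivWithinAt)
      (fun u hu => by
        refine (norm_mul_le _ _).trans ?_
        rw [norm_neg]
        have := hC ⟨u, hu⟩
        rw [hsm] at this
        gcongr
        exact this)
      (Set.mem_Ici.2 le_rfl) (Set.mem_Ici.2 t.2)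
    rw [hsm, norm_sub_rev]
    simpa using h
  have hbd : ∀ t : ℝ≥0, ‖1 - NormedSpace.exp (-(((t : ℝ) : ℂ) • a))‖ ≤ 1 + C := fun t =>
    (norm_sub_le _ _).trans (by rw [norm_one]; gcongr; exact hC t)
  -- The factor 2 comes from `1 - e^{-t} ≥ t/(1+t)`, which is at least `t/2` for `t ≤ 1` and at
  -- least `1/2` for `t ≥ 1`.
  refine ⟨2 * (C * ‖a‖ + (1 + C)), fun t => ?_⟩
  have he : (t : ℝ) / (1 + t) ≤ 1 - Real.exp (-t) := by
    have h1 : Real.exp (-t) ≤ (1 + (t : ℝ))⁻¹ := by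
      rw [Real.exp_neg]
      exact inv_anti₀ (by positivity) (by linarith [Real.add_one_le_exp (t : ℝ)])
    have h2 : (t : ℝ) / (1 + t) = 1 - (1 + (t : ℝ))⁻¹ := by
      have : (1 + (t : ℝ)) ≠ 0 := by positivity
      field_simp
      ring
    linarith
  have hca : 0 ≤ C * ‖a‖ := by positivity
  rcases le_total (t : ℝ) 1 with h | h
  · have h3 : (t : ℝ) / 2 ≤ t / (1 + t) := by
      gcongr
      linarith
    refine (hlip t).trans ?_
    nlinarith [t.2]
  · have h3 : (1 : ℝ) / 2 ≤ t / (1 + t) := by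
      rw [div_le_div_iff₀ (by norm_num) (by positivity)]
      linarith
    refine (hbd t).trans ?_
    nlinarith

end Exponential

/-! ### Shot noise on subsets -/

/-- The contribution `∑_{X_k ∈ B} Y_k` to the shot noise of the points in `B`. -/
noncomputable def shotNoiseOn {Ω E : Type*} (N : Ω → ℕ∞) (X : ℕ → Ω → E) (Y : ℕ → Ω → ℝ≥0)
    (B : Set E) (ω : Ω) : ℝ≥0∞ :=
  ∑' k : ℕ, (pointIndices N X B ω).indicator (fun k => (Y k ω : ℝ≥0∞)) k

section ShotNoise

variable {Ω E : Type*} {N : Ω → ℕ∞} {X : ℕ → Ω → E} {Y : ℕ → Ω → ℝ≥0}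

theorem shotNoiseOn_univ : shotNoiseOn N X Y Set.univ = shotNoise N Y := by
  ext ω
  refine tsum_congr fun k => ?_
  simp [Set.indicator, pointIndices]

/-- Monotone convergence for the counting measure on indices; the limit may be `∞`. -/
theorem tendsto_shotNoiseOn {B : ℕ → Set E} (hB : Monotone B) (hu : ⋃ j, B j = Set.univ) (ω : Ω) :
    Filter.Tendsto (fun j => shotNoiseOn N X Y (B j) ω) Filter.atTop (nhds (shotNoise N Y ω)) := by
  rw [← shotNoiseOn_univ (X := X)]
  simp only [shotNoiseOn, ← lintegral_count]
  refine lintegral_tendsto_of_tendsto_of_monotone (fun j => .of_discrete)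
    (.of_forall fun k i j hij => ?_) (.of_forall fun k => ?_)
  · exact Set.indicator_le_indicator_of_subset (s := pointIndices N X (B i) ω)
      (t := pointIndices N X (B j) ω) (fun l hl => ⟨hl.1, hB hij hl.2⟩) (fun _ => zero_le) k
  · have hk : X k ω ∈ ⋃ j, B j := hu ▸ Set.mem_univ _
    obtain ⟨i, hi⟩ := Set.mem_iUnion.1 hk
    refine tendsto_const_nhds.congr' ?_
    filter_upwards [Filter.eventually_ge_atTop i] with j hj
    have : X k ω ∈ B j := hB hj hi
    simp [Set.indicator, pointIndices, this]

theorem extendZero_shotNoiseOn {A : Type*} [NormedCommRing A] {f : ℝ≥0 → A}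
    (hf : IsVanishingSemigroup f) {B : Set E} {ω : Ω} (hω : (pointIndices N X B ω).Finite) :
    extendZero f (shotNoiseOn N X Y B ω) = ∏ᶠ k ∈ pointIndices N X B ω, f (Y k ω) := by
  obtain ⟨s, hs⟩ := hω.exists_finset_coe
  rw [shotNoiseOn, ← hs, finprod_mem_coe_finset, ← hf.map_sum, ← extendZero_coe f,
    ← tsum_subtype (s : Set ℕ) fun k => (Y k ω : ℝ≥0∞), Finset.tsum_subtype' s
      fun k => (Y k ω : ℝ≥0∞), ENNReal.ofNNReal_finsetSum]

theorem measurable_shotNoise [MeasurableSpace Ω] (hN : Measurable N) (hY : ∀ k, Measurable (Y k)) :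
    Measurable (shotNoise N Y) :=
  Measurable.tsum fun k => Measurable.ite
    (hN (Set.to_countable (Set.Ioi (k : ℕ∞))).measurableSet) (hY k).coe_nnreal_ennreal
    measurable_const

end ShotNoise

/-! ### Passage to the whole space and the finite/infinite alternative -/

namespace IsIndependentFieldAlong

variable {Ω E A : Type*} [MeasurableSpace Ω] [PseudoMetricSpace E] [ProperSpace E]
  [MeasurableSpace E] [BorelSpace E]
  {N : Ω → ℕ∞} {X : ℕ → Ω → E} {H : E → Ω → ℝ≥0} {Y : ℕ → Ω → ℝ≥0} {P : Measure Ω}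
  [IsProbabilityMeasure P] {Λ : Measure E} [IsLocallyFiniteMeasure Λ]

section Algebra

variable [NormedCommRing A] [NormOneClass A] [NormedAlgebra ℝ A] [CompleteSpace A]

omit [IsProbabilityMeasure P] [NormOneClass A] [NormedAlgebra ℝ A] [CompleteSpace A]
  [PseudoMetricSpace E] [ProperSpace E] [BorelSpace E] in
theorem integrable_extendZero_shotNoise [IsFiniteMeasure P]
    (hN : Measurable N) (hY : ∀ k, Measurable (Y k)) {f : ℝ≥0 → A}
    (hf : IsVanishingSemigroup f) : Integrable (fun ω => extendZero f (shotNoise N Y ω)) P := by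
  obtain ⟨C, hC⟩ := hf.exists_norm_le
  exact Integrable.of_bound (hf.continuous_extendZero.stronglyMeasurable.comp_measurable
    (measurable_shotNoise hN hY)).aestronglyMeasurable C
    (.of_forall fun ω => IsVanishingSemigroup.norm_extendZero_le hC _)

/-- No integrability over the whole space is needed: `extendZero f` is bounded and continuous on
`[0, ∞]`, so dominated convergence applies even where the shot noise is infinite. Both alternatives
rest on this. -/
theorem tendsto_exp_neg_setIntegral_ball (hH : IsIndependentFieldAlong N X H Y P)
    (hΦ : IsPoissonPointProcess N X Λ P) {f : ℝ≥0 → A} (hf : IsVanishingSemigroup f) (x₀ : E) :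
    Filter.Tendsto (fun j : ℕ => NormedSpace.exp
      (-∫ x in Metric.ball x₀ j, (1 - ∫ ω, f (H x ω) ∂P) ∂Λ)) Filter.atTop
      (nhds (∫ ω, extendZero f (shotNoise N Y ω) ∂P)) := by
  obtain ⟨C, hC⟩ := hf.exists_norm_le
  have h : ∀ j : ℕ, NormedSpace.exp (-∫ x in Metric.ball x₀ j, (1 - ∫ ω, f (H x ω) ∂P) ∂Λ) =
      ∫ ω, extendZero f (shotNoiseOn N X Y (Metric.ball x₀ j) ω) ∂P := by
    intro j
    rw [← hH.integral_finprod_value hΦ measurableSet_ball Metric.isBounded_ball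
      measure_ball_lt_top.ne hf.continuous.stronglyMeasurable hC]
    refine integral_congr_ae ?_
    filter_upwards [hΦ.ae_finite_pointIndices measurableSet_ball Metric.isBounded_ball] with ω hω
    exact (extendZero_shotNoiseOn hf hω).symm
  simp_rw [h]
  refine tendsto_integral_of_dominated_convergence (fun _ => C) (fun j => ?_)
    (integrable_const _) (fun j => .of_forall fun ω => IsVanishingSemigroup.norm_extendZero_le hC _)
    (.of_forall fun ω => ?_)
  · refine (hΦ.aestronglyMeasurable_finprod measurableSet_ball Metric.isBounded_ball
      (B := Metric.ball x₀ j) (g := fun k ω => f (Y k ω)) fun k =>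
        (hf.continuous.stronglyMeasurable.comp_measurable
          (hH.measurable_value k)).aestronglyMeasurable).congr ?_
    filter_upwards [hΦ.ae_finite_pointIndices measurableSet_ball Metric.isBounded_ball] with ω hω
    exact (extendZero_shotNoiseOn hf hω).symm
  · exact (hf.continuous_extendZero.tendsto _).comp (tendsto_shotNoiseOn
      (fun i j hij => Metric.ball_subset_ball (by exact_mod_cast hij)) (Metric.iUnion_ball_nat x₀) ω)

theorem integral_extendZero_shotNoise (hH : IsIndependentFieldAlong N X H Y P)
    (hΦ : IsPoissonPointProcess N X Λ P) {f : ℝ≥0 → A} (hf : IsVanishingSemigroup f)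
    (hi : Integrable (fun x => 1 - ∫ ω, f (H x ω) ∂P) Λ) :
    ∫ ω, extendZero f (shotNoise N Y ω) ∂P =
      NormedSpace.exp (-∫ x, (1 - ∫ ω, f (H x ω) ∂P) ∂Λ) := by
  let _ : NormedAlgebra ℚ A := NormedAlgebra.restrictScalars ℚ ℝ A
  obtain ⟨ω₀⟩ : Nonempty Ω := nonempty_of_isProbabilityMeasure P
  refine tendsto_nhds_unique (hH.tendsto_exp_neg_setIntegral_ball hΦ hf (X 0 ω₀)) ?_
  refine (NormedSpace.exp_continuous.tendsto _).comp (Filter.Tendsto.neg ?_)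
  have h := tendsto_setIntegral_of_monotone (μ := Λ) (f := fun x => 1 - ∫ ω, f (H x ω) ∂P)
    (s := fun j : ℕ => Metric.ball (X 0 ω₀) j)
    (fun j => measurableSet_ball)
    (fun i j hij => Metric.ball_subset_ball (by exact_mod_cast hij)) hi.integrableOn
  simpa only [Metric.iUnion_ball_nat, Measure.restrict_univ] using h

end Algebra

section Scalar

omit [IsProbabilityMeasure P] [PseudoMetricSpace E] [ProperSpace E] [BorelSpace E] in
theorem measurable_laplaceTransform (hH : IsIndependentFieldAlong N X H Y P) (s : ℝ≥0) :
    Measurable fun x => laplaceTransform P (H x) s := by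
  have hf : StronglyMeasurable fun y : ℝ≥0 => Real.exp (-((s : ℝ) * y)) :=
    Continuous.stronglyMeasurable (by fun_prop)
  have h := (hf.integral_kernel (κ := hH.fieldKernel)).measurable
  simp_rw [hH.integral_fieldKernel _ hf] at h
  exact h

omit [PseudoMetricSpace E] [ProperSpace E] [BorelSpace E] in
theorem integrable_exp_neg_mul (hH : IsIndependentFieldAlong N X H Y P) (s : ℝ≥0) (x : E) :
    Integrable (fun ω => Real.exp (-((s : ℝ) * H x ω))) P := by
  have hm := hH.measurable_field x
  refine Integrable.of_bound (C := 1) (Measurable.aestronglyMeasurable (by fun_prop))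
    (.of_forall fun ω => ?_)
  rw [Real.norm_of_nonneg (Real.exp_nonneg _), Real.exp_le_one_iff]
  exact neg_nonpos.2 (by positivity)

omit [PseudoMetricSpace E] [ProperSpace E] [BorelSpace E] in
theorem laplaceTransform_anti (hH : IsIndependentFieldAlong N X H Y P) (x : E) {s t : ℝ≥0}
    (hst : s ≤ t) : laplaceTransform P (H x) t ≤ laplaceTransform P (H x) s := by
  refine integral_mono (hH.integrable_exp_neg_mul t x) (hH.integrable_exp_neg_mul s x) fun ω => ?_
  have : (s : ℝ) ≤ t := hst
  simp only [Real.exp_le_exp, neg_le_neg_iff]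
  gcongr

omit [MeasurableSpace E] [PseudoMetricSpace E] [ProperSpace E] [BorelSpace E] in
theorem laplaceTransform_zero (x : E) : laplaceTransform P (H x) 0 = 1 := by
  simp [laplaceTransform]

omit [PseudoMetricSpace E] [ProperSpace E] [BorelSpace E] in
theorem one_sub_laplaceTransform_nonneg (hH : IsIndependentFieldAlong N X H Y P) (s : ℝ≥0)
    (x : E) : 0 ≤ 1 - laplaceTransform P (H x) s := by
  rw [sub_nonneg, ← laplaceTransform_zero (P := P) (H := H) x]
  exact hH.laplaceTransform_anti x zero_le

omit [PseudoMetricSpace E] [ProperSpace E] [BorelSpace E] in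
theorem tendsto_laplaceTransform_zero (hH : IsIndependentFieldAlong N X H Y P) (x : E) :
    Filter.Tendsto (fun m : ℕ => laplaceTransform P (H x) (1 / ((m : ℝ≥0) + 1))) Filter.atTop
      (nhds 1) := by
  rw [← laplaceTransform_zero (P := P) (H := H) x]
  refine tendsto_integral_of_dominated_convergence (fun _ => 1)
    (fun m => (hH.integrable_exp_neg_mul _ x).1) (integrable_const _)
    (fun m => .of_forall fun ω => ?_) (.of_forall fun ω => ?_)
  · rw [Real.norm_of_nonneg (Real.exp_nonneg _), Real.exp_le_one_iff]
    exact neg_nonpos.2 (by positivity)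
  · have h : Filter.Tendsto (fun m : ℕ => (1 / ((m : ℝ) + 1))) Filter.atTop (nhds 0) :=
      tendsto_one_div_add_atTop_nhds_zero_nat
    refine (Real.continuous_exp.tendsto _).comp (Filter.Tendsto.neg ?_)
    simpa using h.mul_const (H x ω : ℝ)

/-- Since `e^{-sI}`, read as `0` at `I = ∞`, is at most the indicator of `I < ∞`, the probability of
finiteness is at least `exp(-∫ (1 - L_H(s)) dΛ)`. This tends to `1` as `s → 0`, with `1 - L_H(1)` as
dominating function for `s = 1/(m+1)`. -/
theorem ae_shotNoise_lt_top (hH : IsIndependentFieldAlong N X H Y P)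
    (hΦ : IsPoissonPointProcess N X Λ P)
    (hi : ∀ s : ℝ≥0, Integrable (fun x => 1 - laplaceTransform P (H x) s) Λ) :
    ∀ᵐ ω ∂P, shotNoise N Y ω < ∞ := by
  have hI := measurable_shotNoise hΦ.measurable_number hH.measurable_value
  have hmeas : MeasurableSet {ω | shotNoise N Y ω < ∞} := measurableSet_lt hI measurable_const
  have hs : ∀ m : ℕ, (0 : ℝ) < ((1 / ((m : ℝ≥0) + 1) : ℝ≥0) : ℝ) := fun m => by positivity
  have h1 : ∀ m : ℕ, Real.exp
      (-∫ x, (1 - laplaceTransform P (H x) (1 / ((m : ℝ≥0) + 1))) ∂Λ) ≤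
      P.real {ω | shotNoise N Y ω < ∞} := by
    intro m
    have h := hH.integral_extendZero_shotNoise hΦ (IsVanishingSemigroup.real_exp (hs m)) (hi _)
    rw [← Real.exp_eq_exp_ℝ] at h
    refine h.symm.le.trans ?_
    rw [← integral_indicator_one hmeas]
    refine integral_mono (integrable_extendZero_shotNoise hΦ.measurable_number
      hH.measurable_value (IsVanishingSemigroup.real_exp (hs m)))
      ((integrable_const _).indicator hmeas) fun ω => ?_
    by_cases hω : shotNoise N Y ω < ∞
    · rw [Set.indicator_of_mem (show ω ∈ {ω | shotNoise N Y ω < ∞} from hω), extendZero,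
        if_neg hω.ne, Pi.one_apply, Real.exp_le_one_iff]
      exact neg_nonpos.2 (by positivity)
    · rw [Set.indicator_of_notMem (show ω ∉ {ω | shotNoise N Y ω < ∞} from hω), extendZero,
        if_pos (by simpa using hω)]
  have h2 : Filter.Tendsto (fun m : ℕ => Real.exp
      (-∫ x, (1 - laplaceTransform P (H x) (1 / ((m : ℝ≥0) + 1))) ∂Λ)) Filter.atTop (nhds 1) := by
    suffices h : Filter.Tendsto (fun m : ℕ =>
        ∫ x, (1 - laplaceTransform P (H x) (1 / ((m : ℝ≥0) + 1))) ∂Λ) Filter.atTop (nhds 0) by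
      simpa [Function.comp_def] using (Real.continuous_exp.tendsto _).comp h.neg
    rw [← integral_zero E ℝ (μ := Λ)]
    refine tendsto_integral_of_dominated_convergence
      (fun x => 1 - laplaceTransform P (H x) 1) (fun m => (hi _).1) (hi 1)
      (fun m => .of_forall fun x => ?_) (.of_forall fun x => ?_)
    · rw [Real.norm_of_nonneg (hH.one_sub_laplaceTransform_nonneg _ x)]
      refine sub_le_sub_left (hH.laplaceTransform_anti x ?_) _
      rw [div_le_one (by positivity)]
      exact le_add_of_nonneg_left zero_le
    · simpa using (hH.tendsto_laplaceTransform_zero x).const_sub 1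
  have h3 : P.real {ω | shotNoise N Y ω < ∞} = 1 :=
    le_antisymm measureReal_le_one (le_of_tendsto' h2 h1)
  have h4 : P {ω | shotNoise N Y ω < ∞} = 1 := by
    rw [← ofReal_measureReal, h3, ENNReal.ofReal_one]
  exact (prob_compl_eq_zero_iff hmeas).2 h4

/-- If `E e^{-sI}` were positive, taking logarithms would give the integrals of the nonnegative
function `1 - L_H(s)` over growing balls a finite limit, forcing integrability. So the expectation
is `0`, and `e^{-sI}` vanishes only at `I = ∞`. -/
theorem ae_shotNoise_eq_top (hH : IsIndependentFieldAlong N X H Y P)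
    (hΦ : IsPoissonPointProcess N X Λ P)
    (hi : ¬ ∀ s : ℝ≥0, Integrable (fun x => 1 - laplaceTransform P (H x) s) Λ) :
    ∀ᵐ ω ∂P, shotNoise N Y ω = ∞ := by
  push Not at hi
  obtain ⟨s, hs⟩ := hi
  have hs0 : (0 : ℝ) < s := by
    refine NNReal.coe_pos.2 (pos_iff_ne_zero.2 fun h0 => hs ?_)
    simp [h0, laplaceTransform_zero]
  have hf := IsVanishingSemigroup.real_exp hs0
  obtain ⟨ω₀⟩ : Nonempty Ω := nonempty_of_isProbabilityMeasure P
  set x₀ := X 0 ω₀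
  have hlim := hH.tendsto_exp_neg_setIntegral_ball hΦ hf x₀
  have hn : ∀ t, 0 ≤ extendZero (fun t : ℝ≥0 => Real.exp (-(s * t))) t := fun t => by
    rw [extendZero]; split_ifs <;> positivity
  have hion : ∀ j : ℕ, IntegrableOn (fun x => 1 - laplaceTransform P (H x) s)
      (Metric.ball x₀ j) Λ := fun j => by
    refine Measure.integrableOn_of_bounded (M := 1) measure_ball_lt_top.ne
      ((hH.measurable_laplaceTransform s).const_sub 1).aestronglyMeasurable
      (.of_forall fun x => ?_)
    rw [Real.norm_of_nonneg (hH.one_sub_laplaceTransform_nonneg _ x), sub_le_self_iff]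
    exact integral_nonneg fun ω => Real.exp_nonneg _
  have hzero : ∫ ω, extendZero (fun t : ℝ≥0 => Real.exp (-(s * t))) (shotNoise N Y ω) ∂P = 0 := by
    by_contra hne
    have hpos := lt_of_le_of_ne (integral_nonneg fun ω => hn (shotNoise N Y ω)) (Ne.symm hne)
    rw [← Real.exp_eq_exp_ℝ] at hlim
    have hlog := ((Real.continuousAt_log hpos.ne').tendsto.comp hlim).neg
    simp only [Function.comp_def, Real.log_exp, neg_neg] at hlog
    refine hs (AECover.integrable_of_integral_tendsto_of_nonneg_ae
      (aecover_ball tendsto_natCast_atTop_atTop) _ hion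
      (.of_forall (hH.one_sub_laplaceTransform_nonneg s)) hlog)
  rw [integral_eq_zero_iff_of_nonneg (fun ω => hn _)
    (integrable_extendZero_shotNoise hΦ.measurable_number hH.measurable_value hf)] at hzero
  filter_upwards [hzero] with ω hω
  by_contra h
  rw [extendZero, if_neg h] at hω
  exact (Real.exp_pos _).ne' hω

end Scalar

end IsIndependentFieldAlong

/-! ### Transfer from the commutative algebra to matrices -/

section MatrixRepresentation

variable {A : Type*} [NormedCommRing A] [NormOneClass A] [NormedAlgebra ℂ A]
  [FiniteDimensional ℂ A] {n : ℕ}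

omit [NormOneClass A] in
theorem continuous_algHom_matrix (φ : A →ₐ[ℂ] Matrix (Fin n) (Fin n) ℂ) : Continuous φ :=
  φ.toLinearMap.continuous_of_finiteDimensional

omit [NormOneClass A] in
theorem algHom_matrix_exp (φ : A →ₐ[ℂ] Matrix (Fin n) (Fin n) ℂ) (a : A) :
    φ (NormedSpace.exp a) = NormedSpace.exp (φ a) := by
  have : CompleteSpace A := FiniteDimensional.complete ℂ A
  let _ : NormedAlgebra ℚ A := NormedAlgebra.restrictScalars ℚ ℂ A
  let _ : NormedRing (Matrix (Fin n) (Fin n) ℂ) := Matrix.linftyOpNormedRing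
  let _ : NormedAlgebra ℂ (Matrix (Fin n) (Fin n) ℂ) := Matrix.linftyOpNormedAlgebra
  exact NormedSpace.map_exp φ (continuous_algHom_matrix φ) a

/-- The `(i, j)` entry of a representation of a finite-dimensional algebra by matrices. -/
noncomputable def matrixCoeff (φ : A →ₐ[ℂ] Matrix (Fin n) (Fin n) ℂ) (i j : Fin n) : A →L[ℂ] ℂ :=
  LinearMap.toContinuousLinearMap (Matrix.entryLinearMap ℂ ℂ i j ∘ₗ φ.toLinearMap)

omit [NormOneClass A] in
theorem matrixCoeff_apply (φ : A →ₐ[ℂ] Matrix (Fin n) (Fin n) ℂ) (i j : Fin n) (a : A) :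
    matrixCoeff φ i j a = φ a i j := rfl

/-- The decay of the semigroup makes the limit defining `expNegMul` at `∞` equal to `0`, in
agreement with `extendZero`. -/
theorem expNegMul_algHom (φ : A →ₐ[ℂ] Matrix (Fin n) (Fin n) ℂ) {a : A}
    (ha : ∀ z ∈ spectrum ℂ a, 0 < z.re) (t : ℝ≥0∞) : expNegMul (φ a) t =
      φ (extendZero (fun t : ℝ≥0 => NormedSpace.exp (-(((t : ℝ) : ℂ) • a))) t) := by
  have : CompleteSpace A := FiniteDimensional.complete ℂ A
  have hexp : ∀ r : ℝ, NormedSpace.exp (-((r : ℂ) • φ a)) =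
      φ (NormedSpace.exp (-((r : ℂ) • a))) := fun r => by
    rw [algHom_matrix_exp, map_neg, map_smul]
  induction t with
  | top =>
    rw [extendZero_top, map_zero, expNegMul, if_pos rfl]
    refine Filter.Tendsto.limUnder_eq ?_
    have h := ((continuous_algHom_matrix φ).tendsto 0).comp
      ((isVanishingSemigroup_exp ha).tendsto.comp Real.tendsto_toNNReal_atTop)
    rw [map_zero] at h
    refine h.congr' ?_
    filter_upwards [Filter.eventually_ge_atTop 0] with r hr
    simp only [Function.comp_apply, Real.coe_toNNReal r hr, hexp]
  | coe t =>
    rw [extendZero_coe, expNegMul, if_neg ENNReal.coe_ne_top, ENNReal.coe_toReal, hexp]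

variable {Ω E : Type*} [MeasurableSpace Ω] {P : Measure Ω} [IsProbabilityMeasure P]

theorem matrixLaplaceExists_algHom (φ : A →ₐ[ℂ] Matrix (Fin n) (Fin n) ℂ) {a : A}
    (ha : ∀ z ∈ spectrum ℂ a, 0 < z.re) {Z : Ω → ℝ≥0∞} (hZ : Measurable Z) :
    MatrixLaplaceExists P Z (φ a) ∧ matrixLaplace P Z (φ a) =
      φ (∫ ω, extendZero (fun t : ℝ≥0 => NormedSpace.exp (-(((t : ℝ) : ℂ) • a))) (Z ω) ∂P) := by
  have : CompleteSpace A := FiniteDimensional.complete ℂ A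
  have hf := isVanishingSemigroup_exp ha
  obtain ⟨C, hC⟩ := hf.exists_norm_le
  have hi : Integrable
      (fun ω => extendZero (fun t : ℝ≥0 => NormedSpace.exp (-(((t : ℝ) : ℂ) • a))) (Z ω)) P :=
    Integrable.of_bound
      (hf.continuous_extendZero.stronglyMeasurable.comp_measurable hZ).aestronglyMeasurable C
      (.of_forall fun ω => IsVanishingSemigroup.norm_extendZero_le hC _)
  constructor
  · intro i j
    simp_rw [expNegMul_algHom φ ha, ← matrixCoeff_apply]
    exact (matrixCoeff φ i j).integrable_comp hi
  · ext i j
    rw [matrixLaplace, Matrix.of_apply]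
    simp_rw [expNegMul_algHom φ ha, ← matrixCoeff_apply]
    exact (matrixCoeff φ i j).integral_comp_comm hi

/-- The alternative for the matrix Laplace transform of a Poisson shot noise, for a matrix that is
represented by an element of a finite-dimensional commutative algebra. -/
theorem IsIndependentFieldAlong.matrixLaplace_shotNoise [PseudoMetricSpace E] [ProperSpace E]
    [MeasurableSpace E] [BorelSpace E] {Λ : Measure E} [IsLocallyFiniteMeasure Λ]
    {N : Ω → ℕ∞} {X : ℕ → Ω → E} {H : E → Ω → ℝ≥0} {Y : ℕ → Ω → ℝ≥0}
    (hH : IsIndependentFieldAlong N X H Y P) (hΦ : IsPoissonPointProcess N X Λ P)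
    (φ : A →ₐ[ℂ] Matrix (Fin n) (Fin n) ℂ) {a : A} (ha : ∀ z ∈ spectrum ℂ a, 0 < z.re)
    (hi : ∀ s : ℝ≥0, Integrable (fun x => 1 - laplaceTransform P (H x) s) Λ) :
    (∀ i j, Integrable
        (fun x => ((1 : Matrix (Fin n) (Fin n) ℂ) - fieldMatrixLaplace P H (φ a) x) i j) Λ) ∧
      matrixLaplace P (shotNoise N Y) (φ a) =
        NormedSpace.exp (-Matrix.of fun i j =>
          ∫ x, ((1 : Matrix (Fin n) (Fin n) ℂ) - fieldMatrixLaplace P H (φ a) x) i j ∂Λ) := by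
  have : CompleteSpace A := FiniteDimensional.complete ℂ A
  have hf := isVanishingSemigroup_exp ha
  obtain ⟨C, hC⟩ := hf.exists_norm_le
  obtain ⟨K, hK⟩ := exists_norm_one_sub_exp_le ha
  set f : ℝ≥0 → A := fun t => NormedSpace.exp (-(((t : ℝ) : ℂ) • a))
  have hfs : StronglyMeasurable f := hf.continuous.stronglyMeasurable
  have hfH : ∀ x, Integrable (fun ω => f (H x ω)) P := fun x =>
    Integrable.of_bound (hfs.comp_measurable (hH.measurable_field x)).aestronglyMeasurable C
      (.of_forall fun ω => hC _)
  -- The norm is at most `K (1 - L_H(1; x))`, so the scalar hypothesis at `s = 1` suffices.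
  have hint : Integrable (fun x => 1 - ∫ ω, f (H x ω) ∂P) Λ := by
    refine ((hi 1).const_mul K).mono' ?_ (.of_forall fun x => ?_)
    · have h := hfs.integral_kernel (κ := hH.fieldKernel)
      simp_rw [hH.integral_fieldKernel _ hfs] at h
      exact (stronglyMeasurable_const.sub h).aestronglyMeasurable
    · have h1 : 1 - ∫ ω, f (H x ω) ∂P = ∫ ω, (1 - f (H x ω)) ∂P := by
        rw [integral_sub (integrable_const _) (hfH x)]
        simp
      have he := hH.integrable_exp_neg_mul 1 x
      have h2 : K * (1 - laplaceTransform P (H x) 1) =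
          ∫ ω, K * (1 - Real.exp (-(((1 : ℝ≥0) : ℝ) * H x ω))) ∂P := by
        rw [integral_const_mul, integral_sub (integrable_const _) he]
        simp [laplaceTransform]
      rw [h1, h2]
      refine norm_integral_le_of_norm_le (((integrable_const _).sub he).const_mul K)
        (.of_forall fun ω => ?_)
      simpa [f] using hK (H x ω)
  have hfield : ∀ x i j, ((1 : Matrix (Fin n) (Fin n) ℂ) - fieldMatrixLaplace P H (φ a) x) i j =
      matrixCoeff φ i j (1 - ∫ ω, f (H x ω) ∂P) := by
    intro x i j
    rw [fieldMatrixLaplace, (matrixLaplaceExists_algHom φ ha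
      (hH.measurable_field x).coe_nnreal_ennreal).2, matrixCoeff_apply, map_sub, map_one]
    simp_rw [extendZero_coe]
    rfl
  simp_rw [hfield]
  refine ⟨fun i j => (matrixCoeff φ i j).integrable_comp hint, ?_⟩
  rw [(matrixLaplaceExists_algHom φ ha
    (measurable_shotNoise hΦ.measurable_number hH.measurable_value)).2,
    hH.integral_extendZero_shotNoise hΦ hf hint, algHom_matrix_exp, map_neg]
  congr 2
  ext i j
  rw [Matrix.of_apply, (matrixCoeff φ i j).integral_comp_comm hint, matrixCoeff_apply]

end MatrixRepresentation

/-- Every square complex matrix of positive size comes from a finite-dimensional commutative normed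
algebra in which it has no larger spectrum. -/
theorem exists_commutative_representation {n : ℕ} [Nonempty (Fin n)]
    (S : Matrix (Fin n) (Fin n) ℂ) :
    ∃ (A : Type) (_ : NormedCommRing A) (_ : NormOneClass A) (_ : NormedAlgebra ℂ A)
      (_ : FiniteDimensional ℂ A) (φ : A →ₐ[ℂ] Matrix (Fin n) (Fin n) ℂ) (a : A),
      φ a = S ∧ spectrum ℂ a ⊆ spectrum ℂ S := by
  let _ : NormedRing (Matrix (Fin n) (Fin n) ℂ) := Matrix.linftyOpNormedRing
  let _ : NormedAlgebra ℂ (Matrix (Fin n) (Fin n) ℂ) := Matrix.linftyOpNormedAlgebra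
  have : NormOneClass (Matrix (Fin n) (Fin n) ℂ) := Matrix.linfty_opNormOneClass
  have hc : ∀ a b : Algebra.adjoin ℂ {S}, a * b = b * a := mul_comm'
  let _ : NormedCommRing (Algebra.adjoin ℂ {S}) :=
    { (inferInstance : NormedRing (Algebra.adjoin ℂ {S})) with mul_comm := hc }
  let _ : NormedAlgebra ℂ (Algebra.adjoin ℂ {S}) := Subalgebra.toNormedAlgebra _
  have hfd : FiniteDimensional ℂ (Algebra.adjoin ℂ {S}) :=
    FiniteDimensional.finiteDimensional_submodule (Algebra.adjoin ℂ {S}).toSubmodule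
  refine ⟨Algebra.adjoin ℂ {S}, inferInstance, ⟨norm_one (α := Matrix (Fin n) (Fin n) ℂ)⟩,
    inferInstance, hfd, (Algebra.adjoin ℂ {S}).val, ⟨S, Algebra.self_mem_adjoin_singleton ℂ S⟩,
    rfl, fun z hz hu => hz ?_⟩
  -- An element invertible among all matrices is not a zero divisor in the subalgebra; a
  -- finite-dimensional algebra is Artinian, so it is already a unit there.
  have : IsArtinianRing (Algebra.adjoin ℂ {S}) := IsArtinianRing.of_finite ℂ _
  refine IsArtinianRing.isUnit_of_mem_nonZeroDivisors (mem_nonZeroDivisors_iff_right.2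
    fun b hb => ?_)
  have h : (b : Matrix (Fin n) (Fin n) ℂ) * (algebraMap ℂ _ z - S) = 0 := congrArg Subtype.val hb
  exact Subtype.ext ((IsUnit.mul_left_eq_zero hu).1 h)

theorem mainTheorem2 {d n : ℕ} {Ω : Type*} [MeasurableSpace Ω]
    (P : Measure Ω) [IsProbabilityMeasure P]
    (Λ : Measure (EuclideanSpace ℝ (Fin d))) [IsLocallyFiniteMeasure Λ]
    (N : Ω → ℕ∞) (X : ℕ → Ω → EuclideanSpace ℝ (Fin d))
    (hΦ : IsPoissonPointProcess N X Λ P)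
    (H : EuclideanSpace ℝ (Fin d) → Ω → ℝ≥0) (Y : ℕ → Ω → ℝ≥0)
    (hH : IsIndependentFieldAlong N X H Y P)
    (S : Matrix (Fin n) (Fin n) ℂ) (hS : ∀ z ∈ spectrum ℂ S, 0 < z.re) :
    ((∀ s : ℝ≥0, Integrable (fun x => 1 - laplaceTransform P (H x) s) Λ) →
      (∀ᵐ ω ∂P, shotNoise N Y ω < ∞) ∧
      MatrixLaplaceExists P (shotNoise N Y) S ∧
      (∀ x, MatrixLaplaceExists P (fun ω => (H x ω : ℝ≥0∞)) S) ∧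
      (∀ i j, Integrable
        (fun x => ((1 : Matrix (Fin n) (Fin n) ℂ) - fieldMatrixLaplace P H S x) i j) Λ) ∧
      matrixLaplace P (shotNoise N Y) S =
        NormedSpace.exp (-Matrix.of fun i j =>
          ∫ x, ((1 : Matrix (Fin n) (Fin n) ℂ) - fieldMatrixLaplace P H S x) i j ∂Λ)) ∧
    ((¬ ∀ s : ℝ≥0, Integrable (fun x => 1 - laplaceTransform P (H x) s) Λ) →
      (∀ᵐ ω ∂P, shotNoise N Y ω = ∞) ∧
      MatrixLaplaceExists P (shotNoise N Y) S ∧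
      matrixLaplace P (shotNoise N Y) S = 0) := by

  have hI := measurable_shotNoise hΦ.measurable_number hH.measurable_value
  -- For `n = 0` the matrix ring is trivial and cannot satisfy `‖1‖ = 1`; the matrix claims are then
  -- vacuous.
  rcases isEmpty_or_nonempty (Fin n) with hn | hn
  · exact ⟨fun hi => ⟨hH.ae_shotNoise_lt_top hΦ hi, fun i => isEmptyElim i,
      fun x i => isEmptyElim i, fun i => isEmptyElim i, Subsingleton.elim _ _⟩,
      fun hi => ⟨hH.ae_shotNoise_eq_top hΦ hi, fun i => isEmptyElim i, Subsingleton.elim _ _⟩⟩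
  obtain ⟨A, _, _, _, _, φ, a, rfl, hsub⟩ := exists_commutative_representation S
  have ha : ∀ z ∈ spectrum ℂ a, 0 < z.re := fun z hz => hS z (hsub hz)
  obtain ⟨hex, hval⟩ := matrixLaplaceExists_algHom (P := P) φ ha hI
  refine ⟨fun hi => ?_, fun hi => ?_⟩
  · obtain ⟨h1, h2⟩ := hH.matrixLaplace_shotNoise hΦ φ ha hi
    exact ⟨hH.ae_shotNoise_lt_top hΦ hi, hex, fun x => (matrixLaplaceExists_algHom φ ha
      (hH.measurable_field x).coe_nnreal_ennreal).1, h1, h2⟩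
  · have htop := hH.ae_shotNoise_eq_top hΦ hi
    refine ⟨htop, hex, ?_⟩
    rw [hval, integral_eq_zero_of_ae, map_zero]
    filter_upwards [htop] with ω hω
    rw [hω, extendZero_top, Pi.zero_apply]
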